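/- **Setting.** Let $m\ge 1$ agents hold matrices $X_i\in\mathbb{R}^{n_i\times d}$, $n=\sum_i n_i\ge 2$, all of whose rows have Euclidean norm at most $1$, and let $X\in\mathbb{R}^{n\times d}$ be obtained by stacking $X_1,\dots,X_m$ vertically. Let $\lambda_1\ge\lambda_2\ge\dots\ge\lambda_n$ be the eigenvalues of $XX^\top$ and assume that $\lambda_1>\lambda_2>\dots>\lambda_r$, where $r$ is the rank of $XX^\top$. Let $W\in\mathbb{R}^{m\times m}$ be a symmetric doubly stochastic matrix whose off-diagonal entries satisfy $w_{ij}>0$ if and only if $\{i,j\}$ is an edge of a given connected undirected graph on the agents, and let $\lambda_2(W)$ be its second eigenvalue in decreasing order of modulus (an arbitrary real number if $m=1$). For an integer $c\ge 0$ let $$\Xi = D(X)\,\bigl(m\,(W^c\otimes I_d)\bigr)\,D(X)^\top,\qquad D(X)=\operatorname{diag}(X_1,\dots,X_m)\ \text{(block diagonal)},$$ let $\mu_1,\dots,\mu_n$ be the eigenvalues of $\Xi$ with multiplicity, ordered so that $|\mu_1|\ge\dots\ge|\mu_n|$, and assume $\|\Xi-XX^\top\|_2\le\lambda_1-\lambda_2$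 and $\mu_2\ne 0$. Let $v$ be a unit eigenvector of $XX^\top$ for $\lambda_1$. **Algorithm.** Let $\alpha\ne0$, $\sigma_q>0$, $\sigma_p(1),\sigma_p(2),\dots\in\mathbb{R}$, and let $T\ge0$ be an integer. Let $q^{(0)}\sim\mathcal N(0,\sigma_q^2I_n)$ and $p^{(t)}\sim\mathcal N(0,\sigma_p(t)^2I_n)$, $1\le t\le T$, be independent; $q_i$ and $p_i$ denote the blocks belonging to agent $i$. For $t=1,\dots,T$ agent $i$ computes $z_i^{(t)}=X_i^\top q_i^{(t-1)}$, then $z_i^{(t+1/2)}=m\sum_j (W^c)_{ij}z_j^{(t)}$, and then $q_i^{(t)}=\alpha X_i z_i^{(t+1/2)}+p_i^{(t)}$. **Claim.** The unnormalized output satisfies $q^{(T)}\sim\mathcal N(0,\Omega)$, where $$\Omega=\sigma_q^2(\alpha\Xi)^{T}\bigl((\alpha\Xi)^{T}\bigr)^\top+\sum_{k=1}^{T}\sigma_p(k)^2(\alpha\Xi)^{T-k}\bigl((\alpha\Xi)^{T-k}\bigr)^\top .$$ Put $P=I-vv^\top$ and $Q=\Omega^{1/2}P\,\Omega^{1/2}$.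 Let $\gamma\in(0,1)$, and let $\Theta,\Delta\in\mathbb{R}$ be such that $$\Theta=1-\frac{v^\top\Omega v}{\operatorname{Tr}\Omega}+\Delta,\qquad \Delta\ \ge\ \mathcal D:=\frac{2\|Q-\Theta\Omega\|_F\sqrt{\log(1/\gamma)}+2\|Q-\Theta\Omega\|_2\log(1/\gamma)}{\operatorname{Tr}\Omega}.$$ Let $$\rho=\frac{\sigma_q^2+\sum_{k=1}^{T}(\alpha\mu_2)^{-2k}\sigma_p(k)^2}{\sigma_q^2+\sum_{k=1}^{T}(\alpha\mu_1)^{-2k}\sigma_p(k)^2}.$$ Then, with probability at least $1-\gamma$, $q^{(T)}\neq0$ and $$\frac{\|(I-vv^\top)q^{(T)}\|^2}{\|q^{(T)}\|^2}\ \le\ \mathcal D+2\left(\frac{(\max_i n_i)\,m\,|\lambda_2(W)|^{c}}{\lambda_1-\lambda_2}+(n-1)\,\rho\left(\frac{\mu_2}{\mu_1}\right)^{2T}\right).$$ -/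

import Mathlib

open MeasureTheory ProbabilityTheory
open scoped Matrix Kronecker MatrixOrder Matrix.Norms.L2Operator

namespace DPPM

/-- Global row indices of data split row-wise among `m` agents: agent `i` holds the
rows `⟨i, a⟩` with `a : Fin (ns i)`. -/
abbrev Row {m : ℕ} (ns : Fin m → ℕ) : Type := (i : Fin m) × Fin (ns i)

/-- The global data matrix: the local data matrices stacked vertically. -/
def stack {m d : ℕ} {ns : Fin m → ℕ} (X : (i : Fin m) → Matrix (Fin (ns i)) (Fin d) ℝ) :
    Matrix (Row ns) (Fin d) ℝ :=
  Matrix.of fun r k => X r.1 r.2 k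

/-- The Gram matrix `X Xᵀ` of the global data matrix. -/
def gram {m d : ℕ} {ns : Fin m → ℕ} (X : (i : Fin m) → Matrix (Fin (ns i)) (Fin d) ℝ) :
    Matrix (Row ns) (Row ns) ℝ :=
  stack X * (stack X)ᵀ

/-- The block diagonal matrix `D(X)` with diagonal blocks `X₁, …, Xₘ`. -/
def blockDiag {m d : ℕ} {ns : Fin m → ℕ} (X : (i : Fin m) → Matrix (Fin (ns i)) (Fin d) ℝ) :
    Matrix (Row ns) (Fin m × Fin d) ℝ :=
  Matrix.of fun r jk => if r.1 = jk.1 then X r.1 r.2 jk.2 else 0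

/-- The consensus matrix `Ξ = D(X) (m (W^c ⊗ I_d)) D(X)ᵀ`. -/
def consensusMatrix {m d : ℕ} {ns : Fin m → ℕ}
    (X : (i : Fin m) → Matrix (Fin (ns i)) (Fin d) ℝ) (W : Matrix (Fin m) (Fin m) ℝ) (c : ℕ) :
    Matrix (Row ns) (Row ns) ℝ :=
  blockDiag X * ((m : ℝ) • ((W ^ c) ⊗ₖ (1 : Matrix (Fin d) (Fin d) ℝ))) * (blockDiag X)ᵀ

/-- `W` is a mixing matrix of the undirected graph `G` of agents: `G` is connected, `W` is
symmetric and doubly stochastic, and its off-diagonal entries are positive exactly on the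
edges of `G`. -/
structure IsMixingMatrix {m : ℕ} (G : SimpleGraph (Fin m)) (W : Matrix (Fin m) (Fin m) ℝ) :
    Prop where
  pos_iff_adj : ∀ i j, i ≠ j → (0 < W i j ↔ G.Adj i j)
  symm : W.IsSymm
  stochastic : W ∈ doublyStochastic ℝ (Fin m)
  connected : G.Connected

/-- `μ 1, …, μ N` are the eigenvalues of the real symmetric `N × N` matrix `A`, repeated
according to multiplicity and ordered by decreasing modulus (for a positive semidefinite
matrix, this is the decreasing order). -/
def IsEigenvalueList {ι : Type*} [Fintype ι] [DecidableEq ι] (A : Matrix ι ι ℝ) (μ : ℕ → ℝ) :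
    Prop :=
  (∃ u : OrthonormalBasis (Fin (Fintype.card ι)) ℝ (EuclideanSpace ℝ ι),
    ∀ i, A.toEuclideanLin (u i) = μ (i + 1) • u i) ∧
  ∀ i j, 1 ≤ i → i ≤ j → j ≤ Fintype.card ι → |μ j| ≤ |μ i|

/-- The vector `z_i` that agent `i` computes from its part of the iterate `q`: `X_iᵀ q_i`. -/
def localEmbedding {m d : ℕ} {ns : Fin m → ℕ}
    (X : (i : Fin m) → Matrix (Fin (ns i)) (Fin d) ℝ) (q : EuclideanSpace ℝ (Row ns))
    (i : Fin m) : Fin d → ℝ :=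
  (X i)ᵀ *ᵥ fun a => q ⟨i, a⟩

/-- The result of `c` consensus steps at agent `i`: `m ∑ⱼ (W^c)_{ij} z_j`. -/
def consensus {m d : ℕ} (W : Matrix (Fin m) (Fin m) ℝ) (c : ℕ) (z : Fin m → Fin d → ℝ)
    (i : Fin m) : Fin d → ℝ :=
  (m : ℝ) • ∑ j, (W ^ c) i j • z j

/-- The unnormalized iterates `q^(t)` of the decentralized differentially private power
method, started from `q0`, with noise `p t` added in iteration `t = 1, 2, …`: agent `i` sets
`q_i^(t) = α X_i z_i^(t+1/2) + p_i^(t)`. -/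
noncomputable def iterate {m d : ℕ} {ns : Fin m → ℕ}
    (X : (i : Fin m) → Matrix (Fin (ns i)) (Fin d) ℝ) (W : Matrix (Fin m) (Fin m) ℝ) (c : ℕ)
    (α : ℝ) (q0 : EuclideanSpace ℝ (Row ns)) (p : ℕ → EuclideanSpace ℝ (Row ns)) :
    ℕ → EuclideanSpace ℝ (Row ns)
  | 0 => q0
  | t + 1 => WithLp.toLp 2 fun r =>
      α * (X r.1 *ᵥ consensus W c (localEmbedding X (iterate X W c α q0 p t)) r.1) r.2
        + p (t + 1) r

/-- The sequence `q0, p 1, p 2, …` of all random inputs. -/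
def inputs {S E : Type*} (q0 : S → E) (p : ℕ → S → E) : ℕ → S → E
  | 0 => q0
  | t + 1 => p (t + 1)

/-- The covariance matrix `Ω` of the last iterate:
`σ_q² (αΞ)^T ((αΞ)^T)ᵀ + ∑_{k=1}^T σ_p(k)² (αΞ)^(T-k) ((αΞ)^(T-k))ᵀ`. -/
noncomputable def outputCov {ι : Type*} [Fintype ι] [DecidableEq ι] (Ξ : Matrix ι ι ℝ)
    (α σq : ℝ) (σp : ℕ → ℝ) (T : ℕ) : Matrix ι ι ℝ :=
  σq ^ 2 • ((α • Ξ) ^ T * ((α • Ξ) ^ T)ᵀ) +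
    ∑ k ∈ Finset.Icc 1 T, σp k ^ 2 • ((α • Ξ) ^ (T - k) * ((α • Ξ) ^ (T - k))ᵀ)

/-- The projection `I - v vᵀ`. -/
def projPerp {ι : Type*} [DecidableEq ι] (v : EuclideanSpace ℝ ι) :
    Matrix ι ι ℝ :=
  1 - Matrix.vecMulVec v.ofLp v.ofLp

/-- `Q = Ω^(1/2) (I - v vᵀ) Ω^(1/2)`. -/
noncomputable def sandwich {ι : Type*} [Fintype ι] [DecidableEq ι] (Ω : Matrix ι ι ℝ)
    (v : EuclideanSpace ℝ ι) : Matrix ι ι ℝ :=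
  CFC.sqrt Ω * projPerp v * CFC.sqrt Ω

/-- The Frobenius norm. -/
noncomputable def frobNorm {ι : Type*} [Fintype ι] (A : Matrix ι ι ℝ) : ℝ :=
  Real.sqrt (∑ i, ∑ j, A i j ^ 2)

/-- The deviation term
`(2 ‖Q - ΘΩ‖_F √(log (1/γ)) + 2 ‖Q - ΘΩ‖₂ log (1/γ)) / Tr Ω`
(`‖·‖` is the operator norm induced by the Euclidean norm). -/
noncomputable def deviation {ι : Type*} [Fintype ι] [DecidableEq ι] (Ω : Matrix ι ι ℝ)
    (v : EuclideanSpace ℝ ι) (Θ γ : ℝ) : ℝ :=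
  (2 * frobNorm (sandwich Ω v - Θ • Ω) * Real.sqrt (Real.log (1 / γ)) +
    2 * ‖sandwich Ω v - Θ • Ω‖ * Real.log (1 / γ)) / Ω.trace

/-- The ratio of noise variances
`ρ = (σ_q² + ∑_{k=1}^T (αμ₂)^(-2k) σ_p(k)²) / (σ_q² + ∑_{k=1}^T (αμ₁)^(-2k) σ_p(k)²)`. -/
noncomputable def noiseRatio (α μ₁ μ₂ σq : ℝ) (σp : ℕ → ℝ) (T : ℕ) : ℝ :=
  (σq ^ 2 + ∑ k ∈ Finset.Icc 1 T, ((α * μ₂) ^ (2 * k))⁻¹ * σp k ^ 2) /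
    (σq ^ 2 + ∑ k ∈ Finset.Icc 1 T, ((α * μ₁) ^ (2 * k))⁻¹ * σp k ^ 2)

/-- The squared sine `‖(I - v vᵀ) q‖² / ‖q‖²` of the angle between a unit vector `v` and `q`. -/
noncomputable def sinSq {ι : Type*} [Fintype ι] [DecidableEq ι] (v q : EuclideanSpace ℝ ι) : ℝ :=
  ‖(projPerp v).toEuclideanLin q‖ ^ 2 / ‖q‖ ^ 2

end DPPM

/-! The recursion is affine, `q^(t) = αΞ q^(t-1) + p^(t)`, so the output is a fixed linear image of
independent Gaussian vectors; this gives its law (`hasLaw_iterate`).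

For the tail bound write `y = Ω^(1/2) g` with `g` standard Gaussian and `u = Ω^(1/2) v`. The event
`‖Py‖² > Θ‖y‖²` says that `gᵀMg > 0` for `M = Q - ΘΩ = (1-Θ)Ω - uuᵀ`, a matrix of trace `-Δ Tr Ω`.
The Laurent–Massart inequality bounds its probability by `γ` as soon as the deviation term is at
most `Δ`.

It remains to bound `1 - vᵀΩv / Tr Ω` by the explicit term `B` of the claim. `Ω` is diagonal in an
eigenbasis `u₁, u₂, …` of `Ξ`; its other eigenvalues are at most `τ = ρ (μ₂/μ₁)^(2T)` times the one
belonging to `u₁`. Moreover `⟨u₁, v⟩²` is near `1` by a sine theorem (`one_sub_inner_sq_le`), since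
`Ξ - XXᵀ` is small: `W^c` contracts geometrically on the complement of the constants
(`norm_consensusMatrix_sub_gram_le`).

There is one obstacle. `Δ` is bounded only from below, so `Θ` may exceed the target `R = 𝒟 + B`, and
the tail bound at `Θ` is then too weak. It is applied at `R` instead, which requires that the
deviation term at `R` be at most the one at `Θ` (`deviation_mono`). Raising the threshold subtracts
a nonnegative multiple of `Ω` from `M`, and both norms grow under this, provided `⟨M, Ω⟩ ≤ 0`
(Frobenius) and `Tr M ≤ 0` (operator norm). Both signs follow from `one_sub_mul_sum_le_sum_mul`,
used with the eigenvalues of `Ω` and with their squares. -/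

namespace DPPM

/-! ### Gaussian law of the output -/

section Law

variable {ι : Type*} [Fintype ι] [DecidableEq ι]

theorem posSemidef_sum_smul_mul_transpose {ι κ : Type*} [Fintype ι] (t : Finset κ) (s : κ → ℝ)
    (A : κ → Matrix ι ι ℝ) : (∑ k ∈ t, s k ^ 2 • (A k * (A k)ᵀ)).PosSemidef := by
  refine Matrix.posSemidef_sum _ fun k _ => ?_
  have := Matrix.posSemidef_self_mul_conjTranspose (A k)
  rw [Matrix.conjTranspose_eq_transpose_of_trivial] at this
  exact this.smul (sq_nonneg _)

theorem posSemidef_smul_one {ι : Type*} [DecidableEq ι] (s : ℝ) : (s ^ 2 • (1 : Matrix ι ι ℝ)).PosSemidef :=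
  Matrix.PosSemidef.one.smul (sq_nonneg _)

theorem charFun_map_toEuclideanCLM (ν : Measure (EuclideanSpace ℝ ι)) (A : Matrix ι ι ℝ)
    (x : EuclideanSpace ℝ ι) :
    charFun (ν.map (Matrix.toEuclideanCLM (𝕜 := ℝ) A)) x =
      charFun ν (Matrix.toEuclideanCLM (𝕜 := ℝ) Aᵀ x) := by
  rw [charFun_apply, charFun_apply, integral_map (by fun_prop) (by fun_prop)]
  refine integral_congr_ae (.of_forall fun y => ?_)
  simp only
  congr 3
  rw [Matrix.inner_toEuclideanCLM, real_inner_comm, Matrix.inner_toEuclideanCLM,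
    Matrix.dotProduct_mulVec, ← Matrix.mulVec_transpose, dotProduct_comm]

/-- A linear combination with matrix coefficients of independent isotropic centered Gaussian
vectors is a centered Gaussian vector. -/
theorem hasLaw_sum_toEuclideanCLM {κ S : Type*} [Fintype κ] [MeasurableSpace S] {P : Measure S}
    (s : κ → ℝ) (A : κ → Matrix ι ι ℝ) {Y : κ → S → EuclideanSpace ℝ ι}
    (hY : ∀ k, HasLaw (Y k) (multivariateGaussian 0 (s k ^ 2 • 1)) P) (hind : iIndepFun Y P) :
    HasLaw (fun ω => ∑ k, Matrix.toEuclideanCLM (𝕜 := ℝ) (A k) (Y k ω))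
      (multivariateGaussian 0 (∑ k, s k ^ 2 • (A k * (A k)ᵀ))) P := by
  have := hind.isProbabilityMeasure
  have hm : ∀ k, AEMeasurable (fun ω => Matrix.toEuclideanCLM (𝕜 := ℝ) (A k) (Y k ω)) P :=
    fun k => (Matrix.toEuclideanCLM (𝕜 := ℝ) (A k)).continuous.measurable.comp_aemeasurable
      (hY k).aemeasurable
  have hsum : AEMeasurable (fun ω => ∑ k, Matrix.toEuclideanCLM (𝕜 := ℝ) (A k) (Y k ω)) P :=
    Finset.aemeasurable_fun_sum _ fun k _ => hm k
  refine ⟨hsum, ?_⟩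
  have := Measure.isProbabilityMeasure_map hsum
  -- The covariances may be singular, so there need not be densities to compare; characteristic
  -- functions cover every case.
  refine Measure.ext_of_charFun ?_
  have hind' : iIndepFun (fun k ω => Matrix.toEuclideanCLM (𝕜 := ℝ) (A k) (Y k ω)) P :=
    hind.comp (fun k => Matrix.toEuclideanCLM (𝕜 := ℝ) (A k))
      fun k => (Matrix.toEuclideanCLM (𝕜 := ℝ) (A k)).continuous.measurable
  rw [hind'.charFun_map_fun_sum_eq_prod hm]
  ext x
  rw [Finset.prod_apply,
    charFun_multivariateGaussian (posSemidef_sum_smul_mul_transpose Finset.univ s A)]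
  have key : ∀ k, charFun (P.map fun ω => Matrix.toEuclideanCLM (𝕜 := ℝ) (A k) (Y k ω)) x =
      Complex.exp (-((x.ofLp ⬝ᵥ (s k ^ 2 • (A k * (A k)ᵀ)) *ᵥ x.ofLp : ℝ) : ℂ) / 2) := by
    intro k
    have h1 : P.map (fun ω => Matrix.toEuclideanCLM (𝕜 := ℝ) (A k) (Y k ω)) =
        (multivariateGaussian 0 (s k ^ 2 • 1)).map (Matrix.toEuclideanCLM (𝕜 := ℝ) (A k)) := by
      rw [← (hY k).map_eq, AEMeasurable.map_map_of_aemeasurable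
        (Matrix.toEuclideanCLM (𝕜 := ℝ) (A k)).continuous.measurable.aemeasurable
        (hY k).aemeasurable]
      rfl
    rw [h1, charFun_map_toEuclideanCLM, charFun_multivariateGaussian (posSemidef_smul_one _)]
    congr 1
    simp only [inner_zero_right, Complex.ofReal_zero, zero_mul, zero_sub, neg_div,
      Matrix.ofLp_toEuclideanCLM, Matrix.smul_mulVec, Matrix.one_mulVec, dotProduct_smul,
      ← Matrix.mulVec_mulVec]
    congr 4
    rw [Matrix.dotProduct_mulVec x.ofLp, ← Matrix.mulVec_transpose]
  simp only [key, ← Complex.exp_sum]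
  congr 1
  simp only [inner_zero_right, Complex.ofReal_zero, zero_mul, zero_sub, Matrix.sum_mulVec,
    dotProduct_sum, Complex.ofReal_sum, ← Finset.sum_div, Finset.sum_neg_distrib, neg_div]

variable {m d : ℕ} {ns : Fin m → ℕ} (X : (i : Fin m) → Matrix (Fin (ns i)) (Fin d) ℝ)
  (W : Matrix (Fin m) (Fin m) ℝ) (c : ℕ)

theorem consensusMatrix_apply (r s : Row ns) :
    consensusMatrix X W c r s =
      m * ((W ^ c) r.1 s.1 * ∑ k, X r.1 r.2 k * X s.1 s.2 k) := by
  simp only [consensusMatrix, blockDiag, Matrix.mul_apply, Matrix.transpose_apply, Matrix.of_apply,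
    Matrix.smul_apply, Matrix.kroneckerMap_apply, smul_eq_mul, Fintype.sum_prod_type]
  simp only [ite_mul, zero_mul, mul_ite, mul_zero, Finset.sum_ite_irrel, Finset.sum_const_zero,
    Finset.sum_ite_eq, Finset.mem_univ, if_true, Matrix.one_apply, mul_one,
    Finset.sum_ite_eq']
  rw [Finset.mul_sum, Finset.mul_sum]
  refine Finset.sum_congr rfl fun k _ => ?_
  ring

theorem consensus_localEmbedding (q : EuclideanSpace ℝ (Row ns)) (r : Row ns) :
    (X r.1 *ᵥ consensus W c (localEmbedding X q) r.1) r.2 =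
      (consensusMatrix X W c *ᵥ q.ofLp) r := by
  simp only [Matrix.mulVec, dotProduct, consensus, localEmbedding, consensusMatrix_apply,
    Pi.smul_apply, Finset.sum_apply, smul_eq_mul, Matrix.transpose_apply, Fintype.sum_sigma,
    Finset.mul_sum, Finset.sum_mul]
  rw [Finset.sum_comm]
  refine Finset.sum_congr rfl fun i _ => ?_
  rw [Finset.sum_comm]
  refine Finset.sum_congr rfl fun k _ => Finset.sum_congr rfl fun l _ => ?_
  ring

theorem iterate_succ_eq (α : ℝ) (q0 : EuclideanSpace ℝ (Row ns))
    (p : ℕ → EuclideanSpace ℝ (Row ns)) (t : ℕ) :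
    iterate X W c α q0 p (t + 1) =
      Matrix.toEuclideanCLM (𝕜 := ℝ) (α • consensusMatrix X W c) (iterate X W c α q0 p t)
        + p (t + 1) := by
  ext r
  simp only [iterate, consensus_localEmbedding, PiLp.add_apply, Matrix.ofLp_toEuclideanCLM,
    Matrix.smul_mulVec, Pi.smul_apply, smul_eq_mul]

theorem iterate_eq_sum {S : Type*} (α : ℝ) (q0 : S → EuclideanSpace ℝ (Row ns))
    (p : ℕ → S → EuclideanSpace ℝ (Row ns)) (ω : S) (t : ℕ) :
    iterate X W c α (q0 ω) (fun t => p t ω) t =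
      ∑ k ∈ Finset.range (t + 1), Matrix.toEuclideanCLM (𝕜 := ℝ)
        ((α • consensusMatrix X W c) ^ (t - k)) (inputs q0 p k ω) := by
  induction t with
  | zero => simp [iterate, inputs]
  | succ t ih =>
    rw [iterate_succ_eq, ih, Finset.sum_range_succ _ (t + 1), map_sum]
    congr 1
    · refine Finset.sum_congr rfl fun k hk => ?_
      rw [Finset.mem_range] at hk
      rw [Nat.succ_sub (by omega), pow_succ', map_mul]
      rfl
    · simp [inputs]

/-- The initial vector is treated as noise injected at time `0` with standard deviation `σq`, which
matches the indexing of `inputs`. -/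
theorem outputCov_eq_sum (Ξ : Matrix ι ι ℝ) (α σq : ℝ) (σp : ℕ → ℝ) (T : ℕ) :
    outputCov Ξ α σq σp T = ∑ k : Fin (T + 1), (if (k : ℕ) = 0 then σq else σp k) ^ 2 •
      ((α • Ξ) ^ (T - k) * ((α • Ξ) ^ (T - (k : ℕ)))ᵀ) := by
  rw [Fin.sum_univ_eq_sum_range (fun k => (if k = 0 then σq else σp k) ^ 2 •
      ((α • Ξ) ^ (T - k) * ((α • Ξ) ^ (T - k))ᵀ)), Finset.sum_range_succ', outputCov, add_comm]
  congr 1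
  rw [Finset.range_eq_Ico, Finset.sum_Ico_add' (fun k => (if k = 0 then σq else σp k) ^ 2 •
      ((α • Ξ) ^ (T - k) * ((α • Ξ) ^ (T - k))ᵀ)) 0 T 1]
  refine Finset.sum_congr (by ext; simp) fun k hk => ?_
  rw [Finset.mem_Ico] at hk
  rw [if_neg (by omega)]

theorem hasLaw_iterate (α σq : ℝ) (σp : ℕ → ℝ) (T : ℕ) {S : Type*} [MeasurableSpace S]
    {P : Measure S} (q0 : S → EuclideanSpace ℝ (Row ns))
    (p : ℕ → S → EuclideanSpace ℝ (Row ns))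
    (hq0 : HasLaw q0 (multivariateGaussian 0 (σq ^ 2 • 1)) P)
    (hp : ∀ t ∈ Finset.Icc 1 T, HasLaw (p t) (multivariateGaussian 0 (σp t ^ 2 • 1)) P)
    (hindep : iIndepFun (fun t : Fin (T + 1) => inputs q0 p t) P) :
    HasLaw (fun ω => iterate X W c α (q0 ω) (fun t => p t ω) T)
      (multivariateGaussian 0 (outputCov (consensusMatrix X W c) α σq σp T)) P := by
  rw [outputCov_eq_sum]
  simp only [iterate_eq_sum]
  simp_rw [← Fin.sum_univ_eq_sum_range (fun k => Matrix.toEuclideanCLM (𝕜 := ℝ)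
        ((α • consensusMatrix X W c) ^ (T - k)) (inputs q0 p k _)) (T + 1)]
  refine hasLaw_sum_toEuclideanCLM (fun k : Fin (T + 1) => if (k : ℕ) = 0 then σq else σp k)
    (fun k => (α • consensusMatrix X W c) ^ (T - k)) (fun k => ?_) hindep
  obtain ⟨k, hk⟩ := k
  cases k with
  | zero => simpa [inputs] using hq0
  | succ k =>
    simpa [inputs] using hp (k + 1) (Finset.mem_Icc.2 ⟨by omega, by omega⟩)

end Law

end DPPM

namespace DPPM

/-! ### Tail bounds for Gaussian quadratic forms -/

section Chaos

theorem integrable_exp_mul_sq_gaussianReal {s : ℝ} (hs : s < 1 / 2) :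
    Integrable (fun x => Real.exp (s * x ^ 2)) (gaussianReal 0 1) := by
  rw [gaussianReal_of_var_ne_zero _ one_ne_zero,
    integrable_withDensity_iff_integrable_smul₀' (by fun_prop) (by simp [gaussianPDF])]
  have := (integrable_exp_neg_mul_sq (b := 1 / 2 - s) (by linarith)).const_mul
    (Real.sqrt (2 * Real.pi))⁻¹
  refine this.congr (.of_forall fun x => ?_)
  simp only [gaussianPDF, gaussianPDFReal, smul_eq_mul, NNReal.coe_one, mul_one, sub_zero]
  rw [ENNReal.toReal_ofReal (by positivity), mul_assoc, ← Real.exp_add]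
  ring_nf

theorem integral_exp_mul_sq_gaussianReal {s : ℝ} (hs : s < 1 / 2) :
    ∫ x, Real.exp (s * x ^ 2) ∂(gaussianReal 0 1) = (Real.sqrt (1 - 2 * s))⁻¹ := by
  rw [integral_gaussianReal_eq_integral_smul one_ne_zero]
  have h : ∀ x, gaussianPDFReal 0 1 x • Real.exp (s * x ^ 2) =
      (Real.sqrt (2 * Real.pi))⁻¹ * Real.exp (-(1 / 2 - s) * x ^ 2) := by
    intro x
    simp only [gaussianPDFReal, smul_eq_mul, NNReal.coe_one, mul_one, sub_zero]
    rw [mul_assoc, ← Real.exp_add]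
    ring_nf
  simp_rw [h]
  rw [integral_const_mul, integral_gaussian, ← Real.sqrt_inv, ← Real.sqrt_mul (by positivity),
    ← Real.sqrt_inv]
  congr 1
  have : 1 - 2 * s ≠ 0 := by linarith
  have : 1 / 2 - s ≠ 0 := by linarith
  have := Real.pi_ne_zero
  field_simp

/-- Bounds the moment generating function of one weighted square, for weights of either sign. For `s
≥ 0`, apply `x ≤ sinh x` to `x = -log (1 - 2s)`, which gives `x / 2 ≤ s + s² / (1 - 2s)`. For `s ≤
0`, a rational lower bound for the logarithm gives the stronger exponent `s + s²`. -/
theorem inv_sqrt_one_sub_le_exp {s β : ℝ} (hsβ : 2 * s ≤ β) (hβ0 : 0 ≤ β) (hβ1 : β < 1) :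
    (Real.sqrt (1 - 2 * s))⁻¹ ≤ Real.exp (s + s ^ 2 / (1 - β)) := by
  have hy : 0 < 1 - 2 * s := by linarith
  rw [← Real.log_le_iff_le_exp (by positivity), Real.log_inv, Real.log_sqrt hy.le]
  have hβ : 0 < 1 - β := by linarith
  rcases le_total 0 s with h0 | h0
  · have h1 : s ^ 2 / (1 - 2 * s) ≤ s ^ 2 / (1 - β) := by gcongr
    have hu : 0 ≤ -Real.log (1 - 2 * s) := by
      have := Real.log_nonpos hy.le (by linarith)
      linarith
    have h2 := Real.self_le_sinh_iff.2 hu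
    rw [Real.sinh_eq, neg_neg, Real.exp_neg, Real.exp_log hy] at h2
    have h3 : ((1 - 2 * s)⁻¹ - (1 - 2 * s)) / 2 = 2 * s + 2 * (s ^ 2 / (1 - 2 * s)) := by
      field_simp
      ring
    linarith
  · have h1 : s ^ 2 ≤ s ^ 2 / (1 - β) := by
      rw [le_div_iff₀ hβ]
      nlinarith [sq_nonneg s]
    have h2 := Real.le_log_one_add_of_nonneg (x := -(2 * s)) (by linarith)
    have h3 : -(2 * s) - (2 * s) ^ 2 / 2 ≤ 2 * -(2 * s) / (-(2 * s) + 2) := by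
      rw [le_div_iff₀ (by linarith)]
      nlinarith [mul_nonneg (sq_nonneg s) (neg_nonneg.2 h0)]
    rw [← sub_eq_add_neg] at h2
    linarith

variable {ι : Type*} [Fintype ι]

/-- The Laurent–Massart upper tail bound for weighted sums of squares of independent standard
Gaussian variables. -/
theorem measureReal_pi_gaussianReal_sum_mul_sq_ge_le (a : ι → ℝ) {b V x : ℝ} (hab : ∀ i, a i ≤ b)
    (hb : 0 ≤ b) (hV : V = ∑ i, a i ^ 2) (hV0 : 0 < V) (hx : 0 < x) :
    (Measure.pi fun _ : ι => gaussianReal 0 1).real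
      {g | ∑ i, a i + 2 * Real.sqrt V * Real.sqrt x + 2 * b * x ≤ ∑ i, a i * g i ^ 2} ≤
        Real.exp (-x) := by
  set D := Real.sqrt V + 2 * b * Real.sqrt x with hD
  have hsV : 0 < Real.sqrt V := Real.sqrt_pos.2 hV0
  have hsx : 0 < Real.sqrt x := Real.sqrt_pos.2 hx
  have hD0 : 0 < D := by positivity
  -- This Chernoff parameter makes `1 - β = √V / D` for `β = 2tb`, and the exponent then collapses
  -- to exactly `-x`.
  set t := Real.sqrt x / D with ht
  have ht0 : 0 < t := by positivity
  set β := 2 * (t * b) with hβ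
  have hβ1 : 1 - β = Real.sqrt V / D := by
    rw [hβ, ht]
    field_simp
    rw [hD]
    ring
  have hβlt : β < 1 := by
    have : 0 < Real.sqrt V / D := by positivity
    linarith
  have hβ0 : 0 ≤ β := by positivity
  have hs : ∀ i, 2 * (t * a i) ≤ β := fun i => by
    have := hab i
    rw [hβ]
    gcongr
  have hexp : ∀ g : ι → ℝ, Real.exp (t * ∑ i, a i * g i ^ 2) =
      ∏ i, Real.exp ((t * a i) * g i ^ 2) := fun g => by
    rw [← Real.exp_sum, Finset.mul_sum]
    simp only [mul_assoc]
  have hint : Integrable (fun g : ι → ℝ => Real.exp (t * ∑ i, a i * g i ^ 2))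
      (Measure.pi fun _ : ι => gaussianReal 0 1) := by
    simp_rw [hexp]
    exact Integrable.fintype_prod (f := fun i y => Real.exp ((t * a i) * y ^ 2)) fun i =>
      integrable_exp_mul_sq_gaussianReal (by linarith [hs i])
  refine (measure_ge_le_exp_mul_mgf (X := fun g : ι → ℝ => ∑ i, a i * g i ^ 2) _ ht0.le
    hint).trans ?_
  have hmgf : mgf (fun g : ι → ℝ => ∑ i, a i * g i ^ 2)
      (Measure.pi fun _ : ι => gaussianReal 0 1) t ≤
        Real.exp (t * ∑ i, a i + t ^ 2 * V / (1 - β)) := by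
    rw [mgf]
    simp_rw [hexp]
    rw [integral_fintype_prod_eq_prod (fun i y => Real.exp ((t * a i) * y ^ 2))]
    have hle : ∀ i, ∫ y, Real.exp (t * a i * y ^ 2) ∂gaussianReal 0 1 ≤
        Real.exp (t * a i + (t * a i) ^ 2 / (1 - β)) := fun i => by
      rw [integral_exp_mul_sq_gaussianReal (by linarith [hs i])]
      exact inv_sqrt_one_sub_le_exp (hs i) hβ0 hβlt
    refine (Finset.prod_le_prod (fun i _ => integral_nonneg fun y => (Real.exp_pos _).le)
      fun i _ => hle i).trans_eq ?_
    rw [← Real.exp_sum, Finset.sum_add_distrib, ← Finset.sum_div, hV, Finset.mul_sum,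
      Finset.mul_sum]
    simp only [mul_pow]
  refine (mul_le_mul_of_nonneg_left hmgf (Real.exp_pos _).le).trans_eq ?_
  rw [← Real.exp_add]
  congr 1
  have h1 : t ^ 2 * V / (1 - β) = x * Real.sqrt V / D := by
    rw [hβ1, ht, div_pow, Real.sq_sqrt hx.le]
    nth_rw 1 [← Real.sq_sqrt hV0.le]
    field_simp
  have h2 : t * (2 * Real.sqrt V * Real.sqrt x + 2 * b * x) = x * (Real.sqrt V + D) / D := by
    rw [ht, div_mul_eq_mul_div, div_left_inj' hD0.ne', hD]
    linear_combination 2 * Real.sqrt V * Real.sq_sqrt hx.le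
  have h3 : x * (Real.sqrt V + D) / D = x * Real.sqrt V / D + x := by
    field_simp
  rw [h1]
  linear_combination -h2 - h3

theorem frobNorm_sq (A : Matrix ι ι ℝ) : frobNorm A ^ 2 = (Aᵀ * A).trace := by
  rw [frobNorm, Real.sq_sqrt (by positivity), Matrix.trace, Finset.sum_comm]
  simp [Matrix.mul_apply, sq]

theorem frobNorm_nonneg (A : Matrix ι ι ℝ) : 0 ≤ frobNorm A := Real.sqrt_nonneg _

variable [DecidableEq ι]

theorem trace_eq_sum_inner (A : Matrix ι ι ℝ) {κ : Type*} [Fintype κ]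
    (u : OrthonormalBasis κ ℝ (EuclideanSpace ℝ ι)) :
    A.trace = ∑ i, inner ℝ (u i) (Matrix.toEuclideanCLM (𝕜 := ℝ) A (u i)) := by
  rw [← Matrix.trace_toLin_eq A (EuclideanSpace.basisFun ι ℝ).toBasis,
    LinearMap.trace_eq_sum_inner _ u]
  rfl

theorem toEuclideanCLM_eigenvectorBasis {M : Matrix ι ι ℝ} (hM : M.IsHermitian) (i : ι) :
    Matrix.toEuclideanCLM (𝕜 := ℝ) M (hM.eigenvectorBasis i) =
      hM.eigenvalues i • hM.eigenvectorBasis i := by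
  ext j
  simpa using congrFun (hM.mulVec_eigenvectorBasis i) j

/-- Upper tail bound for a Gaussian quadratic form with zero threshold. -/
theorem measureReal_stdGaussian_quadratic_pos_le {M : Matrix ι ι ℝ} (hM : M.IsHermitian) {x : ℝ}
    (hx : 0 < x)
    (hneg : M.trace + 2 * frobNorm M * Real.sqrt x + 2 * ‖M‖ * x ≤ 0) :
    (stdGaussian (EuclideanSpace ℝ ι)).real
      {g | 0 < inner ℝ g (Matrix.toEuclideanCLM (𝕜 := ℝ) M g)} ≤ Real.exp (-x) := by
  set u := hM.eigenvectorBasis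
  set a := hM.eigenvalues
  have hu : ∀ i, Matrix.toEuclideanCLM (𝕜 := ℝ) M (u i) = a i • u i :=
    toEuclideanCLM_eigenvectorBasis hM
  have hle : ∀ i, |a i| ≤ ‖M‖ := fun i => by
    have h := Matrix.l2_opNorm_mulVec M (u i)
    have h' : ‖Matrix.toEuclideanCLM (𝕜 := ℝ) M (u i)‖ ≤ ‖M‖ * ‖u i‖ := h
    rw [hu, norm_smul, u.norm_eq_one, mul_one, mul_one] at h'
    exact h'
  have htr : M.trace = ∑ i, a i := by
    rw [trace_eq_sum_inner M u]
    refine Finset.sum_congr rfl fun i _ => ?_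
    rw [hu, inner_smul_right, real_inner_self_eq_norm_sq, u.norm_eq_one]
    simp
  have hfr : frobNorm M ^ 2 = ∑ i, a i ^ 2 := by
    rw [frobNorm_sq, ← Matrix.conjTranspose_eq_transpose_of_trivial, hM.eq,
      trace_eq_sum_inner _ u]
    refine Finset.sum_congr rfl fun i _ => ?_
    rw [map_mul, mul_apply_eq_comp, hu, map_smul, hu, smul_smul, inner_smul_right,
      real_inner_self_eq_norm_sq, u.norm_eq_one]
    ring
  have hquad : ∀ g : ι → ℝ, inner ℝ (∑ i, g i • u i)
      (Matrix.toEuclideanCLM (𝕜 := ℝ) M (∑ i, g i • u i)) = ∑ i, a i * g i ^ 2 := fun g => by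
    simp only [map_sum, map_smul, hu, smul_smul]
    rw [u.orthonormal.inner_sum]
    exact Finset.sum_congr rfl fun i _ => by simp; ring
  have hcont : Continuous fun g : EuclideanSpace ℝ ι =>
      inner ℝ g (Matrix.toEuclideanCLM (𝕜 := ℝ) M g) := by fun_prop
  have hms : MeasurableSet
      {g : EuclideanSpace ℝ ι | 0 < inner ℝ g (Matrix.toEuclideanCLM (𝕜 := ℝ) M g)} :=
    hcont.measurable measurableSet_Ioi
  rw [stdGaussian_eq_map_pi_orthonormalBasis u, map_measureReal_apply (by fun_prop) hms]
  -- The tail bound needs positive variance. If the Frobenius norm vanishes, so does the form, and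
  -- the strict inequality defines the empty event.
  rcases (frobNorm_nonneg M).eq_or_lt with h0 | h0
  · have ha : ∀ i, a i = 0 := by
      rw [← h0] at hfr
      have := (Finset.sum_eq_zero_iff_of_nonneg (fun i _ => sq_nonneg (a i))).1
        (hfr.symm.trans (by simp))
      exact fun i => by simpa using this i (Finset.mem_univ i)
    have : ((fun g : ι → ℝ => ∑ i, g i • u i) ⁻¹'
        {g | 0 < inner ℝ g (Matrix.toEuclideanCLM (𝕜 := ℝ) M g)}) = ∅ := by
      ext g
      simp only [Set.mem_preimage, Set.mem_ofPred_eq, hquad, ha]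
      simp
    rw [this]
    simp [(Real.exp_pos _).le]
  · refine le_trans ?_ (measureReal_pi_gaussianReal_sum_mul_sq_ge_le a
      (fun i => (le_abs_self _).trans (hle i)) (norm_nonneg M) hfr (by positivity) hx)
    refine measureReal_mono fun g hg => ?_
    simp only [Set.mem_preimage, Set.mem_ofPred_eq, hquad] at hg ⊢
    rw [Real.sqrt_sq h0.le]
    linarith

end Chaos

end DPPM

namespace DPPM

/-! ### Operators diagonal in an orthonormal basis -/

section Eigenbasis

variable {E κ : Type*} [NormedAddCommGroup E] [InnerProductSpace ℝ E] [Fintype κ]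

theorem inner_apply_eigenbasis (u : OrthonormalBasis κ ℝ E) {T : E →L[ℝ] E} {a : κ → ℝ}
    (hu : ∀ i, T (u i) = a i • u i) (i : κ) (x : E) :
    inner ℝ (u i) (T x) = a i * inner ℝ (u i) x := by
  conv_lhs => rw [← u.sum_repr' x]
  simp only [map_sum, map_smul, hu, smul_smul]
  rw [u.orthonormal.inner_right_fintype]
  ring

theorem inner_self_apply_eigenbasis (u : OrthonormalBasis κ ℝ E) {T : E →L[ℝ] E} {a : κ → ℝ}
    (hu : ∀ i, T (u i) = a i • u i) (x : E) :
    inner ℝ x (T x) = ∑ i, a i * inner ℝ (u i) x ^ 2 := by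
  rw [← u.sum_inner_mul_inner x (T x)]
  refine Finset.sum_congr rfl fun i _ => ?_
  rw [inner_apply_eigenbasis u hu, real_inner_comm]
  ring

theorem norm_sq_apply_eigenbasis (u : OrthonormalBasis κ ℝ E) {T : E →L[ℝ] E} {a : κ → ℝ}
    (hu : ∀ i, T (u i) = a i • u i) (x : E) :
    ‖T x‖ ^ 2 = ∑ i, a i ^ 2 * inner ℝ (u i) x ^ 2 := by
  rw [← u.sum_sq_inner_right (T x)]
  refine Finset.sum_congr rfl fun i _ => ?_
  rw [inner_apply_eigenbasis u hu, mul_pow]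

theorem norm_apply_le_of_eigenbasis (u : OrthonormalBasis κ ℝ E) {T : E →L[ℝ] E} {a : κ → ℝ}
    (hu : ∀ i, T (u i) = a i • u i) {C : ℝ} (hC : 0 ≤ C) (x : E)
    (ha : ∀ i, |a i| ≤ C ∨ inner ℝ (u i) x = 0) : ‖T x‖ ≤ C * ‖x‖ := by
  refine le_of_sq_le_sq ?_ (by positivity)
  rw [norm_sq_apply_eigenbasis u hu, mul_pow, ← u.sum_sq_inner_right x, Finset.mul_sum]
  refine Finset.sum_le_sum fun i _ => ?_
  rcases ha i with h | h
  · exact mul_le_mul_of_nonneg_right (sq_le_sq.2 (by rwa [abs_of_nonneg hC])) (sq_nonneg _)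
  · simp [h]

end Eigenbasis

/-! ### Operator norms of real matrices -/

section MatrixNorm

theorem matrix_norm_le_of_sum_sq_le {ι κ : Type*} [Fintype ι] [Fintype κ] [DecidableEq κ]
    (A : Matrix ι κ ℝ) {C : ℝ} (hC : 0 ≤ C)
    (h : ∀ x : κ → ℝ, ∑ i, (A *ᵥ x) i ^ 2 ≤ C ^ 2 * ∑ j, x j ^ 2) : ‖A‖ ≤ C := by
  rw [Matrix.l2_opNorm_def]
  refine ContinuousLinearMap.opNorm_le_bound _ hC fun x => ?_
  refine le_of_sq_le_sq ?_ (by positivity)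
  rw [mul_pow, EuclideanSpace.real_norm_sq_eq, EuclideanSpace.real_norm_sq_eq]
  exact h x.ofLp

theorem sum_sq_mulVec_le_matrix_norm {ι κ : Type*} [Fintype ι] [Fintype κ] [DecidableEq κ]
    (A : Matrix ι κ ℝ) (x : κ → ℝ) : ∑ i, (A *ᵥ x) i ^ 2 ≤ ‖A‖ ^ 2 * ∑ j, x j ^ 2 := by
  have h := Matrix.l2_opNorm_mulVec A (WithLp.toLp 2 x)
  have h2 := pow_le_pow_left₀ (norm_nonneg _) h 2
  rw [mul_pow, EuclideanSpace.real_norm_sq_eq, EuclideanSpace.real_norm_sq_eq] at h2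
  exact h2

theorem norm_toEuclideanCLM_apply_le {ι : Type*} [Fintype ι] [DecidableEq ι] (A : Matrix ι ι ℝ)
    (x : EuclideanSpace ℝ ι) : ‖Matrix.toEuclideanCLM (𝕜 := ℝ) A x‖ ≤ ‖A‖ * ‖x‖ :=
  Matrix.l2_opNorm_mulVec A x

theorem abs_inner_toEuclideanCLM_le {ι : Type*} [Fintype ι] [DecidableEq ι] (A : Matrix ι ι ℝ)
    (x : EuclideanSpace ℝ ι) : |inner ℝ x (Matrix.toEuclideanCLM (𝕜 := ℝ) A x)| ≤ ‖A‖ * ‖x‖ ^ 2 := by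
  refine (abs_real_inner_le_norm _ _).trans ?_
  have := mul_le_mul_of_nonneg_left (norm_toEuclideanCLM_apply_le A x) (norm_nonneg x)
  linarith

theorem matrix_norm_kronecker_one_le {ι κ : Type*} [Fintype ι] [Fintype κ] [DecidableEq ι]
    [DecidableEq κ] (B : Matrix ι ι ℝ) : ‖B ⊗ₖ (1 : Matrix κ κ ℝ)‖ ≤ ‖B‖ := by
  refine matrix_norm_le_of_sum_sq_le _ (norm_nonneg _) fun x => ?_
  have h : ∀ i k, ((B ⊗ₖ (1 : Matrix κ κ ℝ)) *ᵥ x) (i, k) = (B *ᵥ fun j => x (j, k)) i := by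
    intro i k
    simp [Matrix.mulVec, dotProduct, Fintype.sum_prod_type, Matrix.one_apply]
  simp only [Fintype.sum_prod_type, h]
  rw [Finset.sum_comm, Finset.sum_comm (f := fun i k => x (i, k) ^ 2), Finset.mul_sum]
  exact Finset.sum_le_sum fun k _ => sum_sq_mulVec_le_matrix_norm B _

end MatrixNorm

/-! ### The consensus error -/

section Consensus

variable {m : ℕ} {W : Matrix (Fin m) (Fin m) ℝ}

/-- Cauchy–Schwarz with the weights of a row, which sum to one, bounds each squared entry of `W x`
by a weighted mean of the `x j ^ 2`; summing over the rows uses the column sums. -/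
theorem norm_le_one_of_mem_doublyStochastic (hW : W ∈ doublyStochastic ℝ (Fin m)) : ‖W‖ ≤ 1 := by
  refine matrix_norm_le_of_sum_sq_le _ zero_le_one fun x => ?_
  rw [mem_doublyStochastic_iff_sum] at hW
  obtain ⟨h0, hr, hc⟩ := hW
  have h : ∀ i, (W *ᵥ x) i ^ 2 ≤ ∑ j, W i j * x j ^ 2 := fun i => by
    have := Finset.sum_sq_le_sum_mul_sum_of_sq_le_mul Finset.univ (r := fun j => W i j * x j)
      (f := fun j => W i j) (g := fun j => W i j * x j ^ 2) (fun j _ => h0 i j)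
      (fun j _ => mul_nonneg (h0 i j) (sq_nonneg _)) (fun j _ => by ring_nf; rfl)
    rwa [hr, one_mul] at this
  refine (Finset.sum_le_sum fun i _ => h i).trans_eq ?_
  rw [Finset.sum_comm, one_pow, one_mul]
  simp only [← Finset.sum_mul, hc, one_mul]

theorem toEuclideanCLM_toLp_one (hW : W ∈ doublyStochastic ℝ (Fin m)) :
    Matrix.toEuclideanCLM (𝕜 := ℝ) W (WithLp.toLp 2 1) = WithLp.toLp 2 1 := by
  rw [Matrix.toEuclideanCLM_toLp, mulVec_one_of_mem_doublyStochastic hW]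

theorem inner_toLp_one_toEuclideanCLM (hW : W ∈ doublyStochastic ℝ (Fin m))
    (x : EuclideanSpace ℝ (Fin m)) :
    inner ℝ (WithLp.toLp 2 1) (Matrix.toEuclideanCLM (𝕜 := ℝ) W x) =
      inner ℝ (WithLp.toLp 2 1) x := by
  rw [Matrix.inner_toEuclideanCLM, Matrix.dotProduct_mulVec,
    one_vecMul_of_mem_doublyStochastic hW]
  simp [PiLp.inner_apply, dotProduct]

/-- On the orthogonal complement of the constants a doubly stochastic matrix contracts by the
second largest modulus of an eigenvalue. -/
theorem norm_toEuclideanCLM_apply_le_of_sum_eq_zero (hm : 0 < m)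
    (hW : W ∈ doublyStochastic ℝ (Fin m)) {w : ℕ → ℝ} (hw : IsEigenvalueList W w)
    {x : EuclideanSpace ℝ (Fin m)} (hx : inner ℝ (WithLp.toLp 2 (1 : Fin m → ℝ)) x = 0) :
    ‖Matrix.toEuclideanCLM (𝕜 := ℝ) W x‖ ≤ |w 2| * ‖x‖ := by
  obtain ⟨⟨u, hu⟩, hord⟩ := hw
  replace hu : ∀ i, Matrix.toEuclideanCLM (𝕜 := ℝ) W (u i) = w (i + 1) • u i := hu
  -- If `|w 2| ≥ 1`, then `‖W‖ ≤ 1` suffices. Otherwise only the first index can carry the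
  -- eigenvalue `1`, so the constant vector is a multiple of `u i₀` and `x` has no component there.
  rcases le_or_gt 1 |w 2| with h1 | h1
  · calc ‖Matrix.toEuclideanCLM (𝕜 := ℝ) W x‖ ≤ ‖W‖ * ‖x‖ := norm_toEuclideanCLM_apply_le W x
      _ ≤ |w 2| * ‖x‖ := by
        gcongr
        exact (norm_le_one_of_mem_doublyStochastic hW).trans h1
  set e : EuclideanSpace ℝ (Fin m) := WithLp.toLp 2 1 with he
  have he0 : e ≠ 0 := fun h => by
    have := congrArg (fun y : EuclideanSpace ℝ (Fin m) => y ⟨0, hm⟩) h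
    simp [he] at this
  let i₀ : Fin (Fintype.card (Fin m)) := ⟨0, by simpa using hm⟩
  have hle : ∀ i, i ≠ i₀ → |w (i + 1)| ≤ |w 2| := fun i hi => by
    refine hord 2 _ (by norm_num) ?_ i.2
    have : (i : ℕ) ≠ 0 := fun h => hi (Fin.ext h)
    omega
  have horth : ∀ i, i ≠ i₀ → inner ℝ (u i) e = 0 := fun i hi => by
    have h := inner_apply_eigenbasis u hu i e
    rw [he, toEuclideanCLM_toLp_one hW, ← he] at h
    by_contra hne
    have : w (i + 1) = 1 := by
      have : (w (i + 1) - 1) * inner ℝ (u i) e = 0 := by linarith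
      rcases mul_eq_zero.1 this with h | h
      · linarith
      · exact absurd h hne
    have := hle i hi
    rw [‹w (i + 1) = 1›, abs_one] at this
    linarith
  have hprod : inner ℝ e (u i₀) * inner ℝ (u i₀) x = 0 := by
    rw [← hx, ← u.sum_inner_mul_inner e x, Finset.sum_eq_single i₀]
    · intro i _ hi
      rw [real_inner_comm, horth i hi, zero_mul]
    · simp
  have hne : inner ℝ e (u i₀) ≠ 0 := fun h => he0 <| by
    rw [← u.sum_repr' e, Finset.sum_eq_zero]
    intro i _
    rcases eq_or_ne i i₀ with rfl | hi
    · rw [real_inner_comm, h, zero_smul]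
    · rw [horth i hi, zero_smul]
  have hx0 := (mul_eq_zero.1 hprod).resolve_left hne
  refine norm_apply_le_of_eigenbasis u hu (abs_nonneg _) x fun i => ?_
  rcases eq_or_ne i i₀ with rfl | hi
  · exact .inr hx0
  · exact .inl (hle i hi)

theorem norm_toEuclideanCLM_pow_apply_le_of_sum_eq_zero (hm : 0 < m)
    (hW : W ∈ doublyStochastic ℝ (Fin m)) {w : ℕ → ℝ} (hw : IsEigenvalueList W w)
    {x : EuclideanSpace ℝ (Fin m)} (hx : inner ℝ (WithLp.toLp 2 (1 : Fin m → ℝ)) x = 0) (c : ℕ) :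
    inner ℝ (WithLp.toLp 2 (1 : Fin m → ℝ)) (Matrix.toEuclideanCLM (𝕜 := ℝ) (W ^ c) x) = 0 ∧
      ‖Matrix.toEuclideanCLM (𝕜 := ℝ) (W ^ c) x‖ ≤ |w 2| ^ c * ‖x‖ := by
  induction c with
  | zero => simp [hx]
  | succ c ih =>
    rw [pow_succ', map_mul, mul_apply_eq_comp, inner_toLp_one_toEuclideanCLM hW]
    refine ⟨ih.1, (norm_toEuclideanCLM_apply_le_of_sum_eq_zero hm hW hw ih.1).trans ?_⟩
    rw [pow_succ', mul_assoc]
    exact mul_le_mul_of_nonneg_left ih.2 (abs_nonneg _)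

/-- The subtracted matrix averages, so on `x` the difference acts as `W ^ c` on `x` minus its mean.
That vector is orthogonal to the constants, and centering does not increase the norm. -/
theorem norm_pow_sub_const_le (hm : 0 < m) (hW : W ∈ doublyStochastic ℝ (Fin m)) {w : ℕ → ℝ}
    (hw : IsEigenvalueList W w) (c : ℕ) :
    ‖W ^ c - Matrix.of fun _ _ => (m : ℝ)⁻¹‖ ≤ |w 2| ^ c := by
  have hm0 : (m : ℝ) ≠ 0 := by positivity
  refine matrix_norm_le_of_sum_sq_le _ (by positivity) fun x => ?_
  set b : ℝ := (m : ℝ)⁻¹ * ∑ j, x j with hb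
  set y : EuclideanSpace ℝ (Fin m) := WithLp.toLp 2 (fun i => x i - b) with hy
  have hy0 : inner ℝ (WithLp.toLp 2 (1 : Fin m → ℝ)) y = 0 := by
    simp [PiLp.inner_apply, hy, hb]
    field_simp
    ring
  have h := (norm_toEuclideanCLM_pow_apply_le_of_sum_eq_zero hm hW hw hy0 c).2
  have h2 := pow_le_pow_left₀ (norm_nonneg _) h 2
  rw [mul_pow, EuclideanSpace.real_norm_sq_eq, EuclideanSpace.real_norm_sq_eq] at h2
  have hval : ∀ i, (Matrix.toEuclideanCLM (𝕜 := ℝ) (W ^ c) y) i =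
      ((W ^ c - Matrix.of fun _ _ => (m : ℝ)⁻¹) *ᵥ x) i := fun i => by
    have hyx : y.ofLp = x - b • (1 : Fin m → ℝ) := by ext; simp [hy]
    rw [Matrix.ofLp_toEuclideanCLM, hyx, Matrix.mulVec_sub, Matrix.mulVec_smul,
      mulVec_one_of_mem_doublyStochastic (Submonoid.pow_mem _ hW c), Matrix.sub_mulVec]
    simp [Matrix.mulVec, dotProduct, hb, Finset.mul_sum]
  simp only [hval] at h2
  refine h2.trans (mul_le_mul_of_nonneg_left ?_ (by positivity))
  have : ∑ i, y i ^ 2 = ∑ i, x i ^ 2 - m * b ^ 2 := by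
    have hs : ∑ j, x j = m * b := by rw [hb]; field_simp
    simp only [hy, sub_sq, Finset.sum_add_distrib, Finset.sum_sub_distrib, Finset.sum_const,
      Finset.card_univ, Fintype.card_fin, nsmul_eq_mul, mul_assoc, ← Finset.mul_sum]
    rw [← Finset.sum_mul, hs]
    ring
  rw [this]
  have : 0 ≤ (m : ℝ) * b ^ 2 := by positivity
  linarith

variable {d : ℕ} {ns : Fin m → ℕ} {X : (i : Fin m) → Matrix (Fin (ns i)) (Fin d) ℝ}

/-- By Cauchy–Schwarz each row of block `i` contributes at most the squared norm of the `i`-th part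
of `x`, and there are `ns i` such rows. -/
theorem norm_blockDiag_sq_le (hX : ∀ i a, ∑ k, X i a k ^ 2 ≤ 1) :
    ‖blockDiag X‖ ^ 2 ≤ ((Finset.univ.sup ns : ℕ) : ℝ) := by
  rw [← Real.sq_sqrt (Nat.cast_nonneg (Finset.univ.sup ns))]
  refine pow_le_pow_left₀ (norm_nonneg _) (matrix_norm_le_of_sum_sq_le _ (Real.sqrt_nonneg _)
    fun x => ?_) 2
  rw [Real.sq_sqrt (Nat.cast_nonneg _)]
  have h : ∀ r : Row ns, (blockDiag X *ᵥ x) r ^ 2 ≤ ∑ k, x (r.1, k) ^ 2 := fun r => by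
    have h1 : (blockDiag X *ᵥ x) r = ∑ k, X r.1 r.2 k * x (r.1, k) := by
      simp [Matrix.mulVec, dotProduct, blockDiag, Fintype.sum_prod_type,
        Finset.sum_ite_irrel]
    rw [h1]
    refine (Finset.sum_mul_sq_le_sq_mul_sq _ _ _).trans ?_
    exact mul_le_of_le_one_left (Finset.sum_nonneg fun _ _ => sq_nonneg _) (hX _ _)
  refine (Finset.sum_le_sum fun r _ => h r).trans ?_
  rw [Fintype.sum_sigma, Fintype.sum_prod_type, Finset.mul_sum]
  refine Finset.sum_le_sum fun i _ => ?_
  simp only [Finset.sum_const, Finset.card_univ, Fintype.card_fin, nsmul_eq_mul]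
  refine mul_le_mul_of_nonneg_right ?_ (Finset.sum_nonneg fun _ _ => sq_nonneg _)
  exact_mod_cast Finset.le_sup (f := ns) (Finset.mem_univ i)

/-- Perfect averaging reproduces the Gram matrix: with all entries of the mixing matrix equal to
`1/m`, the factor `m` cancels and every pair of blocks is coupled with weight one. -/
theorem consensusMatrix_sub_gram (hm : 0 < m) (c : ℕ) :
    consensusMatrix X W c - gram X = blockDiag X * ((m : ℝ) •
      ((W ^ c - Matrix.of fun _ _ => (m : ℝ)⁻¹ : Matrix (Fin m) (Fin m) ℝ) ⊗ₖ (1 : Matrix (Fin d) (Fin d) ℝ))) *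
        (blockDiag X)ᵀ := by
  have hgram : gram X = blockDiag X * ((m : ℝ) •
      ((Matrix.of fun _ _ => (m : ℝ)⁻¹ : Matrix (Fin m) (Fin m) ℝ) ⊗ₖ (1 : Matrix (Fin d) (Fin d) ℝ))) *
        (blockDiag X)ᵀ := by
    have hm0 : (m : ℝ) ≠ 0 := by positivity
    ext r s
    simp [gram, stack, blockDiag, Matrix.mul_apply, Fintype.sum_prod_type,
      Matrix.one_apply, Finset.sum_ite_irrel]
    refine Finset.sum_congr rfl fun k _ => ?_
    field_simp
  rw [hgram, consensusMatrix, ← Matrix.sub_mul, ← Matrix.mul_sub, ← smul_sub]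
  congr 3
  ext ⟨i, k⟩ ⟨j, l⟩
  simp [sub_mul]

theorem norm_consensusMatrix_sub_gram_le (hm : 0 < m) (hX : ∀ i a, ∑ k, X i a k ^ 2 ≤ 1)
    (hW : W ∈ doublyStochastic ℝ (Fin m)) {w : ℕ → ℝ} (hw : IsEigenvalueList W w) (c : ℕ) :
    ‖consensusMatrix X W c - gram X‖ ≤ ((Finset.univ.sup ns : ℕ) : ℝ) * m * |w 2| ^ c := by
  rw [consensusMatrix_sub_gram hm]
  set K := (W ^ c - Matrix.of fun _ _ => (m : ℝ)⁻¹ : Matrix (Fin m) (Fin m) ℝ) ⊗ₖ (1 : Matrix (Fin d) (Fin d) ℝ)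
  have hK : ‖K‖ ≤ |w 2| ^ c :=
    (matrix_norm_kronecker_one_le _).trans (norm_pow_sub_const_le hm hW hw c)
  have hT : ‖(blockDiag X)ᵀ‖ = ‖blockDiag X‖ := by
    rw [← Matrix.conjTranspose_eq_transpose_of_trivial, Matrix.l2_opNorm_conjTranspose]
  calc ‖blockDiag X * ((m : ℝ) • K) * (blockDiag X)ᵀ‖
      ≤ ‖blockDiag X‖ * ‖(m : ℝ) • K‖ * ‖(blockDiag X)ᵀ‖ :=
        (Matrix.l2_opNorm_mul _ _).trans
          (mul_le_mul_of_nonneg_right (Matrix.l2_opNorm_mul _ _) (norm_nonneg _))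
    _ = ‖blockDiag X‖ ^ 2 * m * ‖K‖ := by
        rw [hT, norm_smul, Real.norm_natCast]
        ring
    _ ≤ ((Finset.univ.sup ns : ℕ) : ℝ) * m * |w 2| ^ c := by
        gcongr
        exact norm_blockDiag_sq_le hX

end Consensus

end DPPM

namespace DPPM

/-! ### Perturbation of the principal eigenvector -/

section Perturbation

variable {ι : Type*} [Fintype ι] [DecidableEq ι]

theorem eigenvalue_nonneg_of_posSemidef {A : Matrix ι ι ℝ} (hA : A.PosSemidef) {a : ℝ}
    {x : EuclideanSpace ℝ ι} (hx : ‖x‖ = 1)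
    (h : Matrix.toEuclideanCLM (𝕜 := ℝ) A x = a • x) : 0 ≤ a := by
  have h1 : inner ℝ x (Matrix.toEuclideanCLM (𝕜 := ℝ) A x) = a := by
    rw [h, inner_smul_right, real_inner_self_eq_norm_sq, hx]
    ring
  rw [← h1, Matrix.inner_toEuclideanCLM]
  simpa using hA.dotProduct_mulVec_nonneg x.ofLp

/-- A sine theorem: if `Ξ` is closer to a positive semidefinite matrix `A` than half the gap
between the two largest eigenvalues of `A`, then an eigenvector of `Ξ` for the eigenvalue of largest
modulus is close to the principal eigenvector of `A`. -/
theorem one_sub_inner_sq_le {A Ξ : Matrix ι ι ℝ} (hA : A.PosSemidef) {lam μ : ℕ → ℝ}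
    (hlam : IsEigenvalueList A lam) (hcard : 2 ≤ Fintype.card ι)
    (hμ : ∀ i j, 1 ≤ i → i ≤ j → j ≤ Fintype.card ι → |μ j| ≤ |μ i|)
    (u : OrthonormalBasis (Fin (Fintype.card ι)) ℝ (EuclideanSpace ℝ ι))
    (hu : ∀ i, Matrix.toEuclideanCLM (𝕜 := ℝ) Ξ (u i) = μ (i + 1) • u i)
    (i₀ : Fin (Fintype.card ι)) (hi₀ : (i₀ : ℕ) = 0)
    {v : EuclideanSpace ℝ ι} (hv : ‖v‖ = 1)
    (hAv : Matrix.toEuclideanCLM (𝕜 := ℝ) A v = lam 1 • v)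
    (hgap : 2 * ‖Ξ - A‖ < lam 1 - lam 2) :
    1 - inner ℝ (u i₀) v ^ 2 ≤ 2 * (‖Ξ - A‖ / (lam 1 - lam 2)) := by
  set e := ‖Ξ - A‖ with he
  have he0 : 0 ≤ e := norm_nonneg _
  have hg0 : 0 < lam 1 - lam 2 := by linarith
  obtain ⟨⟨b, hb⟩, hord⟩ := hlam
  replace hb : ∀ i, Matrix.toEuclideanCLM (𝕜 := ℝ) A (b i) = lam (i + 1) • b i := hb
  have hlam0 : ∀ i : Fin (Fintype.card ι), 0 ≤ lam (i + 1) := fun i =>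
    eigenvalue_nonneg_of_posSemidef hA (b.norm_eq_one i) (hb i)
  have hlam2 : 0 ≤ lam 2 := hlam0 ⟨1, by omega⟩
  have hle : ∀ i, i ≠ i₀ → lam (i + 1) ≤ lam 2 := fun i hi => by
    have hi0 : (i : ℕ) ≠ 0 := fun h => hi (Fin.ext (h.trans hi₀.symm))
    have := hord 2 (i + 1) (by norm_num) (by omega) i.2
    rwa [abs_of_nonneg (hlam0 i), abs_of_nonneg hlam2] at this
  have hv0 : ∀ i, i ≠ i₀ → inner ℝ (b i) v = 0 := fun i hi => by
    have h := inner_apply_eigenbasis b hb i v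
    rw [hAv, inner_smul_right] at h
    have h' : (lam 1 - lam (i + 1)) * inner ℝ (b i) v = 0 := by linarith
    refine (mul_eq_zero.1 h').resolve_left ?_
    have := hle i hi
    linarith
  have hvb : inner ℝ (b i₀) v ^ 2 = 1 := by
    have := b.sum_sq_inner_right v
    rwa [Finset.sum_eq_single i₀ (fun i _ hi => by rw [hv0 i hi]; simp) (by simp), hv,
      one_pow] at this
  have huv : inner ℝ (u i₀) v ^ 2 = inner ℝ (b i₀) (u i₀) ^ 2 := by
    rw [← b.sum_inner_mul_inner (u i₀) v,
      Finset.sum_eq_single i₀ (fun i _ hi => by rw [hv0 i hi]; simp) (by simp), mul_pow, hvb,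
      mul_one, real_inner_comm]
  have hquadA : inner ℝ (u i₀) (Matrix.toEuclideanCLM (𝕜 := ℝ) A (u i₀)) ≤
      lam 1 * inner ℝ (u i₀) v ^ 2 + lam 2 * (1 - inner ℝ (u i₀) v ^ 2) := by
    have hsum := b.sum_sq_inner_right (u i₀)
    rw [u.norm_eq_one, one_pow, ← Finset.add_sum_erase _ _ (Finset.mem_univ i₀)] at hsum
    rw [inner_self_apply_eigenbasis b hb, ← Finset.add_sum_erase _ _ (Finset.mem_univ i₀), huv,
      hi₀, zero_add, ← eq_sub_iff_add_eq'.2 hsum, Finset.mul_sum]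
    gcongr with i hi
    exact hle i (Finset.ne_of_mem_erase hi)
  have hsub : ∀ x, Matrix.toEuclideanCLM (𝕜 := ℝ) Ξ x = Matrix.toEuclideanCLM (𝕜 := ℝ) A x +
      Matrix.toEuclideanCLM (𝕜 := ℝ) (Ξ - A) x := fun x => by
    rw [map_sub]
    simp
  -- Evaluating `Ξ` at `v` shows that its spectral radius is at least `lam 1 - e`.
  have hμ1 : lam 1 - e ≤ |μ 1| := by
    have h1 : ‖Matrix.toEuclideanCLM (𝕜 := ℝ) Ξ v‖ ≤ |μ 1| * ‖v‖ :=
      norm_apply_le_of_eigenbasis u hu (abs_nonneg _) v fun i =>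
        .inl (hμ 1 _ le_rfl (by omega) i.2)
    have h2 := norm_toEuclideanCLM_apply_le (Ξ - A) v
    have h3 := norm_sub_le (Matrix.toEuclideanCLM (𝕜 := ℝ) Ξ v)
      (Matrix.toEuclideanCLM (𝕜 := ℝ) (Ξ - A) v)
    rw [hsub v, add_sub_cancel_right, hAv, norm_smul, hv, mul_one, ← hAv, ← hsub v] at h3
    rw [hv, mul_one] at h1 h2
    have := le_abs_self (lam 1)
    rw [Real.norm_eq_abs] at h3
    linarith
  have hquadE := abs_inner_toEuclideanCLM_le (Ξ - A) (u i₀)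
  rw [u.norm_eq_one, one_pow, mul_one, ← he, abs_le] at hquadE
  have hquadΞ : μ 1 = inner ℝ (u i₀) (Matrix.toEuclideanCLM (𝕜 := ℝ) A (u i₀)) +
      inner ℝ (u i₀) (Matrix.toEuclideanCLM (𝕜 := ℝ) (Ξ - A) (u i₀)) := by
    rw [← inner_add_right, ← hsub, hu, inner_smul_right, real_inner_self_eq_norm_sq,
      u.norm_eq_one, hi₀]
    simp
  have hquad0 : 0 ≤ inner ℝ (u i₀) (Matrix.toEuclideanCLM (𝕜 := ℝ) A (u i₀)) := by
    rw [Matrix.inner_toEuclideanCLM]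
    simpa using hA.dotProduct_mulVec_nonneg (u i₀).ofLp
  -- A negative `μ 1` would be at least `-e` because `A` is positive semidefinite, whence `lam 1 ≤
  -- 2e`, against the gap assumption. The claim follows by comparing with `μ 1 ≤ ⟨u, A u⟩ + e`: each
  -- of the two estimates costs one `e`.
  have hμpos : lam 1 - e ≤ μ 1 := by
    rcases abs_cases (μ 1) with h | h <;> linarith
  rw [← mul_div_assoc, le_div_iff₀ hg0]
  nlinarith

theorem posSemidef_gram {m d : ℕ} {ns : Fin m → ℕ}
    (X : (i : Fin m) → Matrix (Fin (ns i)) (Fin d) ℝ) : (gram X).PosSemidef := by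
  have := Matrix.posSemidef_self_mul_conjTranspose (stack X)
  rwa [Matrix.conjTranspose_eq_transpose_of_trivial] at this

theorem two_le_rank_of_eigenvalue_ne_zero {A : Matrix ι ι ℝ} {lam : ℕ → ℝ}
    (hlam : IsEigenvalueList A lam) (hcard : 2 ≤ Fintype.card ι) (h2 : lam 2 ≠ 0) :
    2 ≤ A.rank := by
  obtain ⟨⟨b, hb⟩, hord⟩ := hlam
  have h1 : lam 1 ≠ 0 := fun h => h2 <| by
    have := hord 1 2 le_rfl (by norm_num) hcard
    rw [h, abs_zero] at this
    exact abs_nonpos_iff.1 this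
  have hmem : ∀ i : Fin (Fintype.card ι), lam (i + 1) ≠ 0 → b i ∈ LinearMap.range A.toEuclideanLin :=
    fun i hi => ⟨(lam (i + 1))⁻¹ • b i, by rw [map_smul, hb, inv_smul_smul₀ hi]⟩
  have hinj : Function.Injective (![⟨0, by omega⟩, ⟨1, by omega⟩] : Fin 2 → Fin (Fintype.card ι)) := by
    intro i j
    fin_cases i <;> fin_cases j <;> simp
  have hli := b.orthonormal.linearIndependent.comp _ hinj
  have hspan : Submodule.span ℝ (Set.range (b ∘ ![⟨0, by omega⟩, ⟨1, by omega⟩])) ≤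
      LinearMap.range A.toEuclideanLin := by
    rw [Submodule.span_le]
    rintro _ ⟨i, rfl⟩
    fin_cases i
    · exact hmem ⟨0, by omega⟩ h1
    · exact hmem ⟨1, by omega⟩ h2
  have h := Submodule.finrank_mono hspan
  rw [finrank_span_eq_card hli, Fintype.card_fin] at h
  rwa [Matrix.rank_eq_finrank_range_toLin A (EuclideanSpace.basisFun ι ℝ).toBasis
    (EuclideanSpace.basisFun ι ℝ).toBasis]

theorem consensusMatrix_eq_zero_of_gram_eq_zero {m d : ℕ} {ns : Fin m → ℕ}
    {X : (i : Fin m) → Matrix (Fin (ns i)) (Fin d) ℝ} (h : gram X = 0)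
    (W : Matrix (Fin m) (Fin m) ℝ) (c : ℕ) : consensusMatrix X W c = 0 := by
  rw [gram, ← Matrix.conjTranspose_eq_transpose_of_trivial,
    Matrix.self_mul_conjTranspose_eq_zero] at h
  have hX : ∀ i a k, X i a k = 0 := fun i a k => congrFun (congrFun h ⟨i, a⟩) k
  ext r s
  simp [consensusMatrix_apply, hX]

theorem eigenvalue_eq_zero_of_eq_zero {μ : ℕ → ℝ}
    (h : IsEigenvalueList (0 : Matrix ι ι ℝ) μ) (i : Fin (Fintype.card ι)) : μ (i + 1) = 0 := by
  obtain ⟨⟨b, hb⟩, -⟩ := h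
  have := hb i
  rw [map_zero, LinearMap.zero_apply, eq_comm, smul_eq_zero] at this
  exact this.resolve_right (b.orthonormal.ne_zero i)

theorem eq_zero_of_eigenvalue_one_eq_zero {A : Matrix ι ι ℝ} {lam : ℕ → ℝ}
    (hlam : IsEigenvalueList A lam) (h : lam 1 = 0) : A = 0 := by
  obtain ⟨⟨b, hb⟩, hord⟩ := hlam
  have h0 : A.toEuclideanLin = 0 := b.toBasis.ext fun i => by
    have := hord 1 (i + 1) le_rfl (by omega) i.2
    rw [h, abs_zero] at this
    rw [OrthonormalBasis.coe_toBasis, hb, abs_nonpos_iff.1 this]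
    simp
  simpa using h0

/-- Distinctness is assumed only up to the rank, so it applies directly when `lam 2 ≠ 0`. If `lam 2
= 0`, then `lam 1 = 0` would force the data to vanish, hence also the consensus matrix,
contradicting `μ 2 ≠ 0`. -/
theorem eigenvalue_gap_pos {m d : ℕ} {ns : Fin m → ℕ}
    {X : (i : Fin m) → Matrix (Fin (ns i)) (Fin d) ℝ} {W : Matrix (Fin m) (Fin m) ℝ} {c : ℕ}
    {lam μ : ℕ → ℝ} (hcard : 2 ≤ Fintype.card (Row ns)) (hlam : IsEigenvalueList (gram X) lam)
    (hμ : IsEigenvalueList (consensusMatrix X W c) μ)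
    (hdist : ∀ i j, 1 ≤ i → i < j → j ≤ (gram X).rank → lam j < lam i) (hμ2 : μ 2 ≠ 0) :
    lam 2 < lam 1 := by
  by_cases h2 : lam 2 = 0
  · have h0 : 0 ≤ lam 1 := by
      obtain ⟨⟨b, hb⟩, -⟩ := hlam
      exact eigenvalue_nonneg_of_posSemidef (posSemidef_gram X)
        (b.norm_eq_one ⟨0, by omega⟩) (hb ⟨0, by omega⟩)
    refine h2 ▸ h0.lt_of_ne fun h1 => hμ2 ?_
    rw [consensusMatrix_eq_zero_of_gram_eq_zero
      (eq_zero_of_eigenvalue_one_eq_zero hlam h1.symm)] at hμ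
    exact eigenvalue_eq_zero_of_eq_zero hμ ⟨1, by omega⟩
  · exact hdist 1 2 le_rfl (by norm_num) (two_le_rank_of_eigenvalue_ne_zero hlam hcard h2)

end Perturbation

/-! ### Spectrum of the output covariance -/

section Covariance

variable {ι : Type*} [Fintype ι] [DecidableEq ι]

/-- The eigenvalue of the covariance matrix belonging to the eigenvalue `x` of the consensus
matrix. -/
noncomputable def covEigenvalue (α σq : ℝ) (σp : ℕ → ℝ) (T : ℕ) (x : ℝ) : ℝ :=
  σq ^ 2 * (α * x) ^ (2 * T) + ∑ k ∈ Finset.Icc 1 T, σp k ^ 2 * (α * x) ^ (2 * (T - k))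

theorem covEigenvalue_nonneg (α σq : ℝ) (σp : ℕ → ℝ) (T : ℕ) (x : ℝ) :
    0 ≤ covEigenvalue α σq σp T x := by
  refine add_nonneg (mul_nonneg (sq_nonneg _) ((even_two_mul _).pow_nonneg _))
    (Finset.sum_nonneg fun k _ => mul_nonneg (sq_nonneg _) ((even_two_mul _).pow_nonneg _))

theorem covEigenvalue_pos {α σq : ℝ} (hα : α ≠ 0) (hσq : 0 < σq) (σp : ℕ → ℝ) (T : ℕ) {x : ℝ}
    (hx : x ≠ 0) : 0 < covEigenvalue α σq σp T x := by
  refine add_pos_of_pos_of_nonneg (mul_pos (by positivity)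
    ((even_two_mul _).pow_pos (mul_ne_zero hα hx)))
    (Finset.sum_nonneg fun k _ => mul_nonneg (sq_nonneg _) ((even_two_mul _).pow_nonneg _))

theorem covEigenvalue_mono (α σq : ℝ) (σp : ℕ → ℝ) (T : ℕ) {x y : ℝ} (h : |x| ≤ |y|) :
    covEigenvalue α σq σp T x ≤ covEigenvalue α σq σp T y := by
  have hp : ∀ j, (α * x) ^ (2 * j) ≤ (α * y) ^ (2 * j) := fun j => by
    rw [pow_mul, pow_mul]
    refine pow_le_pow_left₀ (sq_nonneg _) (sq_le_sq.2 ?_) j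
    rw [abs_mul, abs_mul]
    gcongr
  exact add_le_add (mul_le_mul_of_nonneg_left (hp T) (sq_nonneg _))
    (Finset.sum_le_sum fun k _ => mul_le_mul_of_nonneg_left (hp _) (sq_nonneg _))

theorem covEigenvalue_eq {α : ℝ} (σq : ℝ) (σp : ℕ → ℝ) (T : ℕ) {x : ℝ} (h : α * x ≠ 0) :
    covEigenvalue α σq σp T x = (α * x) ^ (2 * T) *
      (σq ^ 2 + ∑ k ∈ Finset.Icc 1 T, ((α * x) ^ (2 * k))⁻¹ * σp k ^ 2) := by
  rw [covEigenvalue, mul_add, mul_comm (σq ^ 2), Finset.mul_sum]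
  congr 1
  refine Finset.sum_congr rfl fun k hk => ?_
  have hk' := (Finset.mem_Icc.1 hk).2
  rw [Nat.mul_sub, pow_sub₀ _ h (by omega)]
  ring

/-- Pulling `(αx)^(2T)` out of the covariance eigenvalue leaves the sums in `ρ`. So the convergence
factor of the claim is exactly a ratio of two eigenvalues of `Ω`. -/
theorem noiseRatio_mul_eq {α : ℝ} (hα : α ≠ 0) (σq : ℝ) (σp : ℕ → ℝ) (T : ℕ) {x y : ℝ}
    (hx : x ≠ 0) (hy : y ≠ 0) :
    noiseRatio α x y σq σp T * (y / x) ^ (2 * T) =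
      covEigenvalue α σq σp T y / covEigenvalue α σq σp T x := by
  rw [covEigenvalue_eq σq σp T (mul_ne_zero hα hx), covEigenvalue_eq σq σp T (mul_ne_zero hα hy),
    noiseRatio, mul_div_mul_comm, mul_comm, ← div_pow, mul_div_mul_left _ _ hα]

theorem toEuclideanCLM_pow_apply {A : Matrix ι ι ℝ} {a : ℝ} {x : EuclideanSpace ℝ ι}
    (h : Matrix.toEuclideanCLM (𝕜 := ℝ) A x = a • x) (j : ℕ) :
    Matrix.toEuclideanCLM (𝕜 := ℝ) (A ^ j) x = a ^ j • x := by
  induction j with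
  | zero => simp
  | succ j ih => rw [pow_succ, map_mul, mul_apply_eq_comp, h, map_smul, ih, smul_smul, pow_succ']

theorem toEuclideanCLM_smul_apply (A : Matrix ι ι ℝ) (r : ℝ) (x : EuclideanSpace ℝ ι) :
    Matrix.toEuclideanCLM (𝕜 := ℝ) (r • A) x = r • Matrix.toEuclideanCLM (𝕜 := ℝ) A x := by
  rw [map_smul]
  rfl

theorem toEuclideanCLM_outputCov_apply {Ξ : Matrix ι ι ℝ} (hΞ : Ξᵀ = Ξ) (α σq : ℝ) (σp : ℕ → ℝ)
    (T : ℕ) {a : ℝ} {x : EuclideanSpace ℝ ι}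
    (h : Matrix.toEuclideanCLM (𝕜 := ℝ) Ξ x = a • x) :
    Matrix.toEuclideanCLM (𝕜 := ℝ) (outputCov Ξ α σq σp T) x =
      covEigenvalue α σq σp T a • x := by
  have hp : ∀ (s : ℝ) (j : ℕ), Matrix.toEuclideanCLM (𝕜 := ℝ)
      (s • ((α • Ξ) ^ j * ((α • Ξ) ^ j)ᵀ)) x = (s * (α * a) ^ (2 * j)) • x := fun s j => by
    rw [Matrix.transpose_pow, Matrix.transpose_smul, hΞ, ← pow_add, ← two_mul,
      toEuclideanCLM_smul_apply, toEuclideanCLM_pow_apply (a := α * a), smul_smul]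
    rw [toEuclideanCLM_smul_apply, h, smul_smul]
  rw [outputCov, map_add, map_sum, _root_.add_apply, _root_.sum_apply,
    hp, covEigenvalue, add_smul, Finset.sum_smul]
  congr 1
  exact Finset.sum_congr rfl fun k _ => hp _ _

theorem posSemidef_outputCov (Ξ : Matrix ι ι ℝ) (α σq : ℝ) (σp : ℕ → ℝ) (T : ℕ) :
    (outputCov Ξ α σq σp T).PosSemidef := by
  rw [outputCov_eq_sum]
  exact posSemidef_sum_smul_mul_transpose _ _ _

theorem transpose_consensusMatrix {m d : ℕ} {ns : Fin m → ℕ}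
    (X : (i : Fin m) → Matrix (Fin (ns i)) (Fin d) ℝ) {W : Matrix (Fin m) (Fin m) ℝ}
    (hW : W.IsSymm) (c : ℕ) : (consensusMatrix X W c)ᵀ = consensusMatrix X W c := by
  ext r s
  rw [Matrix.transpose_apply, consensusMatrix_apply, consensusMatrix_apply, (hW.pow c).apply]
  simp only [mul_comm (X s.1 s.2 _)]

/-- If weights `p` concentrate on the index of a dominant term, then the weighted sum is nearly the
whole sum. -/
theorem one_sub_mul_sum_le_sum_mul {κ : Type*} [Fintype κ] {a p : κ → ℝ} {i₀ : κ}
    {B₁ B₂ τ : ℝ} (ha : ∀ i, 0 ≤ a i) (hp : ∀ i, 0 ≤ p i) (hτ : ∀ i, i ≠ i₀ → a i ≤ τ * a i₀)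
    (hB₂ : ((Fintype.card κ : ℝ) - 1) * τ ≤ B₂) (hB₂0 : 0 ≤ B₂) (hp₀ : 1 - 2 * B₁ ≤ p i₀)
    (hB₁ : 0 ≤ B₁) (hB : 2 * (B₁ + B₂) ≤ 1) :
    (1 - 2 * (B₁ + B₂)) * ∑ i, a i ≤ ∑ i, a i * p i := by
  classical
  have h1 : ∑ i, a i ≤ (1 + B₂) * a i₀ := by
    rw [← Finset.add_sum_erase _ _ (Finset.mem_univ i₀)]
    have h : ∑ i ∈ Finset.univ.erase i₀, a i ≤ ∑ i ∈ Finset.univ.erase i₀, τ * a i₀ :=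
      Finset.sum_le_sum fun i hi => hτ i (Finset.ne_of_mem_erase hi)
    rw [Finset.sum_const, Finset.card_erase_of_mem (Finset.mem_univ i₀), Finset.card_univ,
      nsmul_eq_mul, Nat.cast_sub (Fintype.card_pos_iff.2 ⟨i₀⟩), Nat.cast_one, ← mul_assoc] at h
    have := mul_le_mul_of_nonneg_right hB₂ (ha i₀)
    linarith
  have h2 : a i₀ * p i₀ ≤ ∑ i, a i * p i :=
    Finset.single_le_sum (f := fun i => a i * p i) (fun i _ => mul_nonneg (ha i) (hp i))
      (Finset.mem_univ i₀)
  have h3 : (1 - 2 * (B₁ + B₂)) * ∑ i, a i ≤ (1 - 2 * (B₁ + B₂)) * ((1 + B₂) * a i₀) :=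
    mul_le_mul_of_nonneg_left h1 (by linarith)
  have h4 : (1 - 2 * (B₁ + B₂)) * (1 + B₂) ≤ 1 - 2 * B₁ := by nlinarith
  have h5 := mul_le_mul_of_nonneg_right h4 (ha i₀)
  have h6 := mul_le_mul_of_nonneg_left hp₀ (ha i₀)
  linarith

end Covariance

end DPPM

namespace DPPM

/-! ### Monotonicity of the deviation term in the threshold -/

section Monotonicity

variable {ι : Type*} [Fintype ι]

theorem frobNorm_le_frobNorm_sub_smul {A B : Matrix ι ι ℝ} {δ : ℝ} (hδ : 0 ≤ δ)
    (h : ∑ i, ∑ j, A i j * B i j ≤ 0) : frobNorm A ≤ frobNorm (A - δ • B) := by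
  refine Real.sqrt_le_sqrt ?_
  have h1 : ∑ i, ∑ j, (A - δ • B) i j ^ 2 = ∑ i, ∑ j, A i j ^ 2 -
      2 * δ * ∑ i, ∑ j, A i j * B i j + δ ^ 2 * ∑ i, ∑ j, B i j ^ 2 := by
    simp only [Finset.mul_sum, ← Finset.sum_sub_distrib, ← Finset.sum_add_distrib]
    refine Finset.sum_congr rfl fun i _ => Finset.sum_congr rfl fun j _ => ?_
    simp only [Matrix.sub_apply, Matrix.smul_apply, smul_eq_mul]
    ring
  have h2 : 0 ≤ δ ^ 2 * ∑ i, ∑ j, B i j ^ 2 := by positivity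
  have h3 := mul_nonpos_of_nonneg_of_nonpos hδ h
  rw [h1]
  linarith

theorem sum_smul_sub_vecMulVec_mul (B : Matrix ι ι ℝ) (u : ι → ℝ) (r : ℝ) :
    ∑ i, ∑ j, (r • B - Matrix.vecMulVec u u) i j * B i j =
      r * frobNorm B ^ 2 - u ⬝ᵥ B *ᵥ u := by
  rw [frobNorm, Real.sq_sqrt (by positivity)]
  simp only [Matrix.sub_apply, Matrix.smul_apply, smul_eq_mul, Matrix.vecMulVec_apply, dotProduct,
    Matrix.mulVec, Finset.mul_sum, ← Finset.sum_sub_distrib]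
  refine Finset.sum_congr rfl fun i _ => Finset.sum_congr rfl fun j _ => ?_
  ring

theorem norm_sq_apply_sum_smul_le {E F κ : Type*} [NormedAddCommGroup E] [NormedSpace ℝ E]
    [NormedAddCommGroup F] [NormedSpace ℝ F] (T : E →L[ℝ] F) (s : Finset κ) (c : κ → ℝ)
    (e : κ → E) : ‖T (∑ j ∈ s, c j • e j)‖ ^ 2 ≤ (∑ j ∈ s, c j ^ 2) * ∑ j ∈ s, ‖T (e j)‖ ^ 2 := by
  have h1 : ‖T (∑ j ∈ s, c j • e j)‖ ≤ ∑ j ∈ s, |c j| * ‖T (e j)‖ := by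
    rw [map_sum]
    refine (norm_sum_le _ _).trans_eq (Finset.sum_congr rfl fun j _ => ?_)
    rw [map_smul, norm_smul, Real.norm_eq_abs]
  refine (pow_le_pow_left₀ (norm_nonneg _) h1 2).trans ?_
  refine (Finset.sum_mul_sq_le_sq_mul_sq _ _ _).trans_eq ?_
  simp only [sq_abs]

variable [DecidableEq ι]

theorem inner_toEuclideanCLM_left (A : Matrix ι ι ℝ) (x y : EuclideanSpace ℝ ι) :
    inner ℝ x (Matrix.toEuclideanCLM (𝕜 := ℝ) A y) =
      inner ℝ (Matrix.toEuclideanCLM (𝕜 := ℝ) Aᵀ x) y := by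
  rw [Matrix.inner_toEuclideanCLM, real_inner_comm, Matrix.dotProduct_mulVec,
    ← Matrix.mulVec_transpose, PiLp.inner_apply]
  simp [dotProduct]

theorem inner_vecMulVec (u x : EuclideanSpace ℝ ι) :
    inner ℝ x (Matrix.toEuclideanCLM (𝕜 := ℝ) (Matrix.vecMulVec u.ofLp u.ofLp) x) =
      inner ℝ u x ^ 2 := by
  have h : inner ℝ u x = u.ofLp ⬝ᵥ x.ofLp := by
    rw [PiLp.inner_apply]
    simp [dotProduct, mul_comm]
  rw [Matrix.inner_toEuclideanCLM, Matrix.vecMulVec_mulVec, h]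
  simp [dotProduct_comm, sq]

theorem transpose_sqrt (Ω : Matrix ι ι ℝ) : (CFC.sqrt Ω)ᵀ = CFC.sqrt Ω := by
  have h : (CFC.sqrt Ω).PosSemidef := Matrix.nonneg_iff_posSemidef.1 (CFC.sqrt_nonneg Ω)
  rw [← Matrix.conjTranspose_eq_transpose_of_trivial, h.isHermitian.eq]

theorem inner_self_toEuclideanCLM_eq_norm_sqrt {Ω : Matrix ι ι ℝ} (hΩ : Ω.PosSemidef)
    (x : EuclideanSpace ℝ ι) :
    inner ℝ x (Matrix.toEuclideanCLM (𝕜 := ℝ) Ω x) =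
      ‖Matrix.toEuclideanCLM (𝕜 := ℝ) (CFC.sqrt Ω) x‖ ^ 2 := by
  conv_lhs => rw [← CFC.sqrt_mul_sqrt_self Ω hΩ.nonneg]
  rw [map_mul, mul_apply_eq_comp, inner_toEuclideanCLM_left, transpose_sqrt,
    real_inner_self_eq_norm_sq]

theorem isHermitian_smul_sub_vecMulVec {κ : Type*} {Ω : Matrix κ κ ℝ} (hΩ : Ω.PosSemidef)
    (u : κ → ℝ) (r : ℝ) : (r • Ω - Matrix.vecMulVec u u).IsHermitian := by
  have h := hΩ.isHermitian.eq
  rw [Matrix.IsHermitian, Matrix.conjTranspose_eq_transpose_of_trivial] at *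
  rw [Matrix.transpose_sub, Matrix.transpose_smul, h, Matrix.transpose_vecMulVec]

/-- A rank one downdate of nonpositive trace of a positive semidefinite matrix attains its operator
norm at the negative eigenvalue, so that the norm increases when the matrix decreases. -/
theorem norm_smul_sub_vecMulVec_le {Ω : Matrix ι ι ℝ} (hΩ : Ω.PosSemidef)
    (u : EuclideanSpace ℝ ι) {r δ : ℝ} (hr : 0 ≤ r) (hδ : 0 ≤ δ) (htr : r * Ω.trace ≤ ‖u‖ ^ 2) :
    ‖r • Ω - Matrix.vecMulVec u.ofLp u.ofLp‖ ≤
      ‖r • Ω - Matrix.vecMulVec u.ofLp u.ofLp - δ • Ω‖ := by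
  set M' := r • Ω - Matrix.vecMulVec u.ofLp u.ofLp with hM'
  set N := ‖M' - δ • Ω‖ with hN
  have hN0 : 0 ≤ N := norm_nonneg _
  have hher : M'.IsHermitian := isHermitian_smul_sub_vecMulVec hΩ _ _
  set e := hher.eigenvectorBasis
  set a := hher.eigenvalues
  have he : ∀ i, Matrix.toEuclideanCLM (𝕜 := ℝ) M' (e i) = a i • e i :=
    toEuclideanCLM_eigenvectorBasis hher
  set q : EuclideanSpace ℝ ι → ℝ :=
    fun x => ‖Matrix.toEuclideanCLM (𝕜 := ℝ) (CFC.sqrt Ω) x‖ ^ 2 with hq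
  have hq0 : ∀ x, 0 ≤ q x := fun x => sq_nonneg _
  have hquad' : ∀ x, inner ℝ x (Matrix.toEuclideanCLM (𝕜 := ℝ) M' x) =
      r * q x - inner ℝ u x ^ 2 := fun x => by
    rw [hM', map_sub, _root_.sub_apply, inner_sub_right, inner_vecMulVec,
      toEuclideanCLM_smul_apply, inner_smul_right, inner_self_toEuclideanCLM_eq_norm_sqrt hΩ]
  have hquad : ∀ x, r * q x - inner ℝ u x ^ 2 - δ * q x ≥ -(N * ‖x‖ ^ 2) := fun x => by
    have h := (abs_le.1 (abs_inner_toEuclideanCLM_le (M' - δ • Ω) x)).1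
    rwa [map_sub, _root_.sub_apply, inner_sub_right, hquad', toEuclideanCLM_smul_apply,
      inner_smul_right, inner_self_toEuclideanCLM_eq_norm_sqrt hΩ] at h
  have ha : ∀ i, a i = r * q (e i) - inner ℝ u (e i) ^ 2 := fun i => by
    rw [← hquad', he, inner_smul_right, real_inner_self_eq_norm_sq, e.norm_eq_one]
    ring
  have htr' : r * ∑ j, q (e j) ≤ ∑ j, inner ℝ u (e j) ^ 2 := by
    rw [e.sum_sq_inner_left]
    rw [trace_eq_sum_inner Ω e] at htr
    simpa only [inner_self_toEuclideanCLM_eq_norm_sqrt hΩ] using htr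
  have hbound : ∀ i, |a i| ≤ N := by
    intro i
    refine abs_le.2 ⟨?_, ?_⟩
    -- Lower bound: adding back `δΩ ≥ 0` can only raise the quadratic form, which is at least `-N`
    -- on unit vectors.
    · have h := hquad (e i)
      rw [e.norm_eq_one] at h
      have := mul_nonneg hδ (hq0 (e i))
      rw [ha]
      linarith
    -- Upper bound: since the trace is nonpositive, `a i` is at most minus the sum of the other
    -- diagonal terms, that is, at most `t - r * R`.
    · set s := Finset.univ.erase i with hs
      set t := ∑ j ∈ s, inner ℝ u (e j) ^ 2 with ht
      set R := ∑ j ∈ s, q (e j) with hR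
      have ht0 : 0 ≤ t := Finset.sum_nonneg fun _ _ => sq_nonneg _
      have hR0 : 0 ≤ R := Finset.sum_nonneg fun _ _ => hq0 _
      have hat : a i ≤ t - r * R := by
        rw [← Finset.add_sum_erase _ _ (Finset.mem_univ i), ← Finset.add_sum_erase _ _
          (Finset.mem_univ i), ← hs, ← ht, ← hR] at htr'
        rw [ha]
        linarith
      rcases ht0.eq_or_lt with h0 | hpos
      · have := mul_nonneg hr hR0
        linarith
      -- The test vector is the projection of `u` onto the complement of `e i`. There `⟨u, w⟩ = ‖w‖²
      -- = t` and, by Cauchy–Schwarz, `q w ≤ t * R`, so the form of `M'` at `w` is at most `t * (r *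
      -- R - t) ≤ -(t * a i)`. It is also at least `-(N * t)`, whence `a i ≤ N`.
      · set w : EuclideanSpace ℝ ι := ∑ j ∈ s, (inner ℝ u (e j) : ℝ) • e j with hw
        have hqw : q w ≤ t * R := norm_sq_apply_sum_smul_le _ s _ _
        have huw : inner ℝ u w = t := by
          rw [hw, inner_sum]
          exact Finset.sum_congr rfl fun j _ => by rw [inner_smul_right, sq]
        have hww : ‖w‖ ^ 2 = t := by
          rw [← real_inner_self_eq_norm_sq, hw, e.orthonormal.inner_sum]
          exact Finset.sum_congr rfl fun j _ => by simp [sq]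
        have h := hquad w
        rw [huw, hww] at h
        have h1 := mul_nonneg hδ (hq0 w)
        have h2 := mul_le_mul_of_nonneg_left hqw hr
        have h3 := mul_le_mul_of_nonneg_left hat ht0
        refine le_of_mul_le_mul_left (?_ : t * a i ≤ t * N) hpos
        nlinarith
  rw [Matrix.l2_opNorm_def]
  exact ContinuousLinearMap.opNorm_le_bound _ hN0 fun x =>
    norm_apply_le_of_eigenbasis e he hN0 x fun i => .inl (hbound i)

theorem sandwich_sub_smul_eq {Ω : Matrix ι ι ℝ} (hΩ : Ω.PosSemidef) (v : EuclideanSpace ℝ ι)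
    (Θ : ℝ) : sandwich Ω v - Θ • Ω = (1 - Θ) • Ω -
      Matrix.vecMulVec (Matrix.toEuclideanCLM (𝕜 := ℝ) (CFC.sqrt Ω) v).ofLp
        (Matrix.toEuclideanCLM (𝕜 := ℝ) (CFC.sqrt Ω) v).ofLp := by
  rw [sandwich, projPerp, Matrix.mul_sub, Matrix.sub_mul, Matrix.mul_one,
    CFC.sqrt_mul_sqrt_self Ω hΩ.nonneg, Matrix.mul_vecMulVec, Matrix.vecMulVec_mul,
    ← Matrix.mulVec_transpose, transpose_sqrt, Matrix.ofLp_toEuclideanCLM, sub_smul, one_smul]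
  abel

theorem dotProduct_mulVec_eq_norm_sqrt {Ω : Matrix ι ι ℝ} (hΩ : Ω.PosSemidef)
    (v : EuclideanSpace ℝ ι) : v.ofLp ⬝ᵥ Ω *ᵥ v.ofLp =
      ‖Matrix.toEuclideanCLM (𝕜 := ℝ) (CFC.sqrt Ω) v‖ ^ 2 := by
  rw [← inner_self_toEuclideanCLM_eq_norm_sqrt hΩ, Matrix.inner_toEuclideanCLM]

theorem trace_sandwich_sub_smul {Ω : Matrix ι ι ℝ} (hΩ : Ω.PosSemidef) (v : EuclideanSpace ℝ ι)
    (Θ : ℝ) : (sandwich Ω v - Θ • Ω).trace = (1 - Θ) * Ω.trace - v.ofLp ⬝ᵥ Ω *ᵥ v.ofLp := by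
  rw [sandwich_sub_smul_eq hΩ, Matrix.trace_sub, Matrix.trace_smul, Matrix.trace_vecMulVec,
    dotProduct_mulVec_eq_norm_sqrt hΩ, EuclideanSpace.real_norm_sq_eq, smul_eq_mul]
  simp [dotProduct, sq]

/-- Going from `Θ'` to `Θ` subtracts `(Θ - Θ') • Ω` from `(1 - Θ') • Ω - uuᵀ`, where `u = Ω^(1/2)
v`. The hypothesis `htr` says that the latter has nonpositive trace, `hfr` that its Frobenius inner
product with `Ω` is nonpositive; they serve the operator and the Frobenius norm respectively. -/
theorem deviation_mono {Ω : Matrix ι ι ℝ} (hΩ : Ω.PosSemidef) {v : EuclideanSpace ℝ ι}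
    {γ Θ Θ' : ℝ} (hγ : γ ∈ Set.Ioo (0 : ℝ) 1) (hΘ : Θ' ≤ Θ) (hΘ1 : Θ' ≤ 1)
    (htr : (1 - Θ') * Ω.trace ≤ v.ofLp ⬝ᵥ Ω *ᵥ v.ofLp)
    (hfr : (1 - Θ') * frobNorm Ω ^ 2 ≤ ‖Matrix.toEuclideanCLM (𝕜 := ℝ) Ω v‖ ^ 2) :
    deviation Ω v Θ' γ ≤ deviation Ω v Θ γ := by
  have hlog : 0 ≤ Real.log (1 / γ) := Real.log_nonneg (by
    rw [le_div_iff₀ hγ.1]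
    linarith [hγ.2])
  have htr0 : 0 ≤ Ω.trace := hΩ.trace_nonneg
  set u := Matrix.toEuclideanCLM (𝕜 := ℝ) (CFC.sqrt Ω) v with hu
  have hM : sandwich Ω v - Θ • Ω =
      (1 - Θ') • Ω - Matrix.vecMulVec u.ofLp u.ofLp - (Θ - Θ') • Ω := by
    rw [sandwich_sub_smul_eq hΩ, sub_smul, sub_smul, sub_smul]
    abel
  have hop : ‖sandwich Ω v - Θ' • Ω‖ ≤ ‖sandwich Ω v - Θ • Ω‖ := by
    rw [hM, sandwich_sub_smul_eq hΩ]
    refine norm_smul_sub_vecMulVec_le hΩ u (by linarith) (by linarith) ?_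
    rwa [dotProduct_mulVec_eq_norm_sqrt hΩ] at htr
  have hF : frobNorm (sandwich Ω v - Θ' • Ω) ≤ frobNorm (sandwich Ω v - Θ • Ω) := by
    rw [hM, sandwich_sub_smul_eq hΩ]
    refine frobNorm_le_frobNorm_sub_smul (by linarith) ?_
    have h : u.ofLp ⬝ᵥ Ω *ᵥ u.ofLp = ‖Matrix.toEuclideanCLM (𝕜 := ℝ) Ω v‖ ^ 2 := by
      rw [dotProduct_mulVec_eq_norm_sqrt hΩ, hu, ← mul_apply_eq_comp, ← map_mul,
        CFC.sqrt_mul_sqrt_self Ω hΩ.nonneg]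
    rw [sum_smul_sub_vecMulVec_mul, h]
    linarith
  unfold deviation
  gcongr

end Monotonicity

/-! ### Concentration of the squared sine -/

section Concentration

variable {ι : Type*} [Fintype ι] [DecidableEq ι]

theorem transpose_projPerp {κ : Type*} [DecidableEq κ] (v : EuclideanSpace ℝ κ) : (projPerp v)ᵀ = projPerp v := by
  rw [projPerp, Matrix.transpose_sub, Matrix.transpose_one, Matrix.transpose_vecMulVec]

theorem norm_projPerp_sq {v : EuclideanSpace ℝ ι} (hv : ‖v‖ = 1) (y : EuclideanSpace ℝ ι) :
    ‖Matrix.toEuclideanCLM (𝕜 := ℝ) (projPerp v) y‖ ^ 2 =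
      inner ℝ y (Matrix.toEuclideanCLM (𝕜 := ℝ) (projPerp v) y) := by
  have hvv : v.ofLp ⬝ᵥ v.ofLp = 1 := by
    have := EuclideanSpace.real_norm_sq_eq v
    rw [hv, one_pow] at this
    rw [this]
    simp [dotProduct, sq]
  have hP : projPerp v * projPerp v = projPerp v := by
    rw [projPerp, Matrix.mul_sub, Matrix.sub_mul, Matrix.mul_one, Matrix.mul_one, Matrix.sub_mul, Matrix.one_mul,
      Matrix.vecMulVec_mul_vecMulVec, hvv]
    simp
  conv_rhs => rw [← hP]
  rw [map_mul, mul_apply_eq_comp, inner_toEuclideanCLM_left, transpose_projPerp,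
    real_inner_self_eq_norm_sq]

theorem norm_projPerp_sq_le {v : EuclideanSpace ℝ ι} (hv : ‖v‖ = 1) (y : EuclideanSpace ℝ ι) :
    ‖Matrix.toEuclideanCLM (𝕜 := ℝ) (projPerp v) y‖ ^ 2 ≤ ‖y‖ ^ 2 := by
  rw [norm_projPerp_sq hv, projPerp, map_sub, _root_.sub_apply, inner_sub_right, inner_vecMulVec,
    map_one, one_apply_eq_self, real_inner_self_eq_norm_sq]
  linarith [sq_nonneg (inner ℝ v y)]

/-- Substituting `y = Ω^(1/2) g` turns the event into positivity of the form of `sandwich Ω v - Θ •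
Ω` at a standard Gaussian `g`. Multiplied by `Tr Ω`, `hdev` is the sign condition of the
zero-threshold tail bound at `x = log (1/γ)`. -/
theorem measureReal_multivariateGaussian_lt_norm_projPerp_le {Ω : Matrix ι ι ℝ}
    (hΩ : Ω.PosSemidef) (htr : 0 < Ω.trace) {v : EuclideanSpace ℝ ι} (hv : ‖v‖ = 1) {γ Θ : ℝ}
    (hγ : γ ∈ Set.Ioo (0 : ℝ) 1)
    (hdev : deviation Ω v Θ γ ≤ Θ - (1 - (v.ofLp ⬝ᵥ Ω *ᵥ v.ofLp) / Ω.trace)) :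
    (multivariateGaussian 0 Ω).real
      {y | Θ * ‖y‖ ^ 2 < ‖Matrix.toEuclideanCLM (𝕜 := ℝ) (projPerp v) y‖ ^ 2} ≤ γ := by
  have hlog : 0 < Real.log (1 / γ) := Real.log_pos (by
    rw [lt_div_iff₀ hγ.1]
    linarith [hγ.2])
  have hher : (sandwich Ω v - Θ • Ω).IsHermitian := by
    rw [sandwich_sub_smul_eq hΩ]
    exact isHermitian_smul_sub_vecMulVec hΩ _ _
  have hneg : (sandwich Ω v - Θ • Ω).trace +
      2 * frobNorm (sandwich Ω v - Θ • Ω) * Real.sqrt (Real.log (1 / γ)) +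
      2 * ‖sandwich Ω v - Θ • Ω‖ * Real.log (1 / γ) ≤ 0 := by
    rw [deviation, div_le_iff₀ htr] at hdev
    rw [trace_sandwich_sub_smul hΩ]
    have : (Θ - (1 - (v.ofLp ⬝ᵥ Ω *ᵥ v.ofLp) / Ω.trace)) * Ω.trace =
        (Θ - 1) * Ω.trace + v.ofLp ⬝ᵥ Ω *ᵥ v.ofLp := by
      field_simp
      ring
    linarith
  have hexp : Real.exp (-Real.log (1 / γ)) = γ := by
    rw [one_div, Real.log_inv, neg_neg, Real.exp_log hγ.1]
  have h := measureReal_stdGaussian_quadratic_pos_le hher hlog hneg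
  rw [hexp] at h
  have hms : MeasurableSet {y : EuclideanSpace ℝ ι |
      Θ * ‖y‖ ^ 2 < ‖Matrix.toEuclideanCLM (𝕜 := ℝ) (projPerp v) y‖ ^ 2} :=
    (isOpen_lt (by fun_prop) (by fun_prop)).measurableSet
  rw [multivariateGaussian, map_measureReal_apply (by fun_prop) hms]
  convert h using 2
  ext g
  set S := CFC.sqrt Ω with hS
  simp only [Set.mem_preimage, Set.mem_ofPred_eq, zero_add]
  have h1 : inner ℝ g (Matrix.toEuclideanCLM (𝕜 := ℝ) (sandwich Ω v - Θ • Ω) g) =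
      ‖Matrix.toEuclideanCLM (𝕜 := ℝ) (projPerp v) (Matrix.toEuclideanCLM (𝕜 := ℝ) S g)‖ ^ 2 -
        Θ * ‖Matrix.toEuclideanCLM (𝕜 := ℝ) S g‖ ^ 2 := by
    rw [map_sub, _root_.sub_apply, inner_sub_right, toEuclideanCLM_smul_apply, inner_smul_right,
      inner_self_toEuclideanCLM_eq_norm_sqrt hΩ, norm_projPerp_sq hv, sandwich, map_mul, map_mul,
      mul_apply_eq_comp, mul_apply_eq_comp, inner_toEuclideanCLM_left, transpose_sqrt]
  rw [h1, sub_pos]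

/-- `Ω` may be singular, but positive trace gives a positive diagonal entry, and the corresponding
coordinate has a nondegenerate Gaussian law. -/
theorem multivariateGaussian_singleton_zero {Ω : Matrix ι ι ℝ} (hΩ : Ω.PosSemidef)
    (htr : 0 < Ω.trace) : multivariateGaussian 0 Ω {0} = 0 := by
  obtain ⟨i, -, hi⟩ := Finset.exists_lt_of_sum_lt (s := Finset.univ) (f := fun _ : ι => (0 : ℝ))
    (g := fun i => Ω i i) (by simpa [Matrix.trace] using htr)
  have hmp := measurePreserving_eval_multivariateGaussian (μ := 0) hΩ (i := i)
  have hna : NullSingletonClass (gaussianReal ((0 : EuclideanSpace ℝ ι) i) (Ω i i).toNNReal) :=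
    nullSingletonClass_gaussianReal (by simpa using hi)
  refine measure_mono_null (t := (fun x : EuclideanSpace ℝ ι => x i) ⁻¹' {0}) (fun x hx => ?_) ?_
  · rw [Set.mem_singleton_iff.1 hx]
    simp
  · rw [hmp.measure_preimage (measurableSet_singleton _).nullMeasurableSet, measure_singleton]

/-- The deviation inequality for `sinSq`: the threshold may be any upper bound of the relaxed
threshold `Θ`, or one below `Θ` at which the deviation term is still monotone. -/
theorem le_measureReal_sinSq_le {Ω : Matrix ι ι ℝ} (hΩ : Ω.PosSemidef) (htr : 0 < Ω.trace)
    {v : EuclideanSpace ℝ ι} (hv : ‖v‖ = 1) {γ Θ B : ℝ} (hγ : γ ∈ Set.Ioo (0 : ℝ) 1)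
    (hdev : deviation Ω v Θ γ ≤ Θ - (1 - (v.ofLp ⬝ᵥ Ω *ᵥ v.ofLp) / Ω.trace))
    (hB : B ≤ 1 → (1 - B) * Ω.trace ≤ v.ofLp ⬝ᵥ Ω *ᵥ v.ofLp ∧
      (1 - B) * frobNorm Ω ^ 2 ≤ ‖Matrix.toEuclideanCLM (𝕜 := ℝ) Ω v‖ ^ 2) :
    1 - γ ≤ (multivariateGaussian 0 Ω).real
      {y | y ≠ 0 ∧ sinSq v y ≤ deviation Ω v Θ γ + B} := by
  set R := deviation Ω v Θ γ + B with hR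
  have hdev0 : 0 ≤ deviation Ω v Θ γ := by
    have hlog : 0 ≤ Real.log (1 / γ) := Real.log_nonneg (by
      rw [le_div_iff₀ hγ.1]
      linarith [hγ.2])
    have := frobNorm_nonneg (sandwich Ω v - Θ • Ω)
    unfold deviation
    positivity
  have hbad : (multivariateGaussian 0 Ω).real
      {y | R * ‖y‖ ^ 2 < ‖Matrix.toEuclideanCLM (𝕜 := ℝ) (projPerp v) y‖ ^ 2} ≤ γ := by
    -- For `R ≥ 1` the event is empty, as a projection does not increase norms. For `Θ ≤ R` the tail
    -- bound at `Θ` is enough. For `R < Θ` it is applied at `R`: there the deviation term is at most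
    -- its value at `Θ`, which is `R - B`, and `B` dominates `1 - vᵀΩv / Tr Ω`.
    rcases le_or_gt 1 R with h1 | h1
    · have : {y | R * ‖y‖ ^ 2 < ‖Matrix.toEuclideanCLM (𝕜 := ℝ) (projPerp v) y‖ ^ 2} = ∅ := by
        ext y
        simp only [Set.mem_ofPred_eq, Set.mem_empty_iff_false, iff_false, not_lt]
        refine (norm_projPerp_sq_le hv y).trans ?_
        exact le_mul_of_one_le_left (sq_nonneg _) h1
      rw [this, measureReal_empty]
      exact hγ.1.le
    · rcases le_or_gt Θ R with h2 | h2
      · refine (measureReal_mono fun y hy => ?_).trans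
          (measureReal_multivariateGaussian_lt_norm_projPerp_le hΩ htr hv hγ hdev)
        rw [Set.mem_ofPred_eq] at hy ⊢
        exact (mul_le_mul_of_nonneg_right h2 (sq_nonneg _)).trans_lt hy
      · have hBR : 1 - R ≤ 1 - B := by linarith
        obtain ⟨hB1, hB2⟩ := hB (by linarith)
        have hRtr := (mul_le_mul_of_nonneg_right hBR htr.le).trans hB1
        have hRfr := (mul_le_mul_of_nonneg_right hBR (sq_nonneg (frobNorm Ω))).trans hB2
        refine measureReal_multivariateGaussian_lt_norm_projPerp_le hΩ htr hv hγ ?_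
        refine (deviation_mono hΩ hγ h2.le h1.le hRtr hRfr).trans ?_
        have : 1 - B ≤ (v.ofLp ⬝ᵥ Ω *ᵥ v.ofLp) / Ω.trace := (le_div_iff₀ htr).2 hB1
        linarith
  set G := {y : EuclideanSpace ℝ ι | y ≠ 0 ∧ sinSq v y ≤ R} with hG
  have hcover : (Set.univ : Set (EuclideanSpace ℝ ι)) ⊆ G ∪ ({0} ∪
      {y | R * ‖y‖ ^ 2 < ‖Matrix.toEuclideanCLM (𝕜 := ℝ) (projPerp v) y‖ ^ 2}) := by
    intro y _
    by_cases hy : y = 0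
    · exact .inr (.inl hy)
    by_cases h : sinSq v y ≤ R
    · exact .inl ⟨hy, h⟩
    · refine .inr (.inr ?_)
      rw [not_le, sinSq, lt_div_iff₀ (by positivity)] at h
      exact h
  have h1 := (measureReal_mono hcover (μ := multivariateGaussian 0 Ω)).trans
    ((measureReal_union_le _ _).trans (add_le_add_right (measureReal_union_le _ _) _))
  rw [probReal_univ, measureReal_def _ {0}, multivariateGaussian_singleton_zero hΩ htr] at h1
  simp only [ENNReal.toReal_zero, zero_add] at h1
  linarith

end Concentration

end DPPM

/-! ### Assembly of the theorem -/

open DPPM in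
theorem theorem3 {m d : ℕ} (ns : Fin m → ℕ) (hn : 2 ≤ ∑ i, ns i)
    -- the data, every row in the closed unit ball
    (X : (i : Fin m) → Matrix (Fin (ns i)) (Fin d) ℝ)
    (hX : ∀ i a, ∑ k, X i a k ^ 2 ≤ 1)
    -- the network
    (G : SimpleGraph (Fin m)) (W : Matrix (Fin m) (Fin m) ℝ) (hW : IsMixingMatrix G W)
    (c : ℕ)
    -- eigenvalues of the Gram matrix, of the consensus matrix and of the mixing matrix
    (lam μ w : ℕ → ℝ)
    (hlam : IsEigenvalueList (gram X) lam)
    (hμ : IsEigenvalueList (consensusMatrix X W c) μ)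
    (hw : IsEigenvalueList W w)
    -- the nonzero eigenvalues of the Gram matrix are distinct
    (hdist : ∀ i j, 1 ≤ i → i < j → j ≤ (gram X).rank → lam j < lam i)
    -- the consensus error is at most the spectral gap
    (hE : ‖consensusMatrix X W c - gram X‖ ≤ lam 1 - lam 2)
    -- a principal eigenvector of the Gram matrix
    (v : EuclideanSpace ℝ (Row ns)) (hv : ‖v‖ = 1)
    (hv_eig : (gram X).toEuclideanLin v = lam 1 • v)
    -- parameters of the algorithm
    (α : ℝ) (hα : α ≠ 0) (hμ2 : μ 2 ≠ 0)
    (σq : ℝ) (hσq : 0 < σq) (σp : ℕ → ℝ) (T : ℕ)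
    -- the independent Gaussian inputs
    {S : Type*} [MeasurableSpace S] (P : Measure S) [IsProbabilityMeasure P]
    (q0 : S → EuclideanSpace ℝ (Row ns)) (p : ℕ → S → EuclideanSpace ℝ (Row ns))
    (hq0 : HasLaw q0 (multivariateGaussian 0 (σq ^ 2 • 1)) P)
    (hp : ∀ t ∈ Finset.Icc 1 T, HasLaw (p t) (multivariateGaussian 0 (σp t ^ 2 • 1)) P)
    (hindep : iIndepFun (fun t : Fin (T + 1) => inputs q0 p t) P)
    -- the output of the algorithm, before normalization
    (q : S → EuclideanSpace ℝ (Row ns))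
    (hq : ∀ s, q s = iterate X W c α (q0 s) (fun t => p t s) T)
    (Ω : Matrix (Row ns) (Row ns) ℝ) (hΩ : Ω = outputCov (consensusMatrix X W c) α σq σp T) :
    HasLaw q (multivariateGaussian 0 Ω) P ∧
    ∀ γ ∈ Set.Ioo (0 : ℝ) 1, ∀ Δ Θ : ℝ,
      Θ = 1 - (v.ofLp ⬝ᵥ Ω *ᵥ v.ofLp) / Ω.trace + Δ →
      deviation Ω v Θ γ ≤ Δ →
      1 - γ ≤ P.real {s | q s ≠ 0 ∧
        sinSq v (q s) ≤ deviation Ω v Θ γ +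
          2 * (((Finset.univ.sup ns : ℕ) : ℝ) * m * |w 2| ^ c / (lam 1 - lam 2) +
            (((∑ i, ns i : ℕ) : ℝ) - 1) * noiseRatio α (μ 1) (μ 2) σq σp T
              * (μ 2 / μ 1) ^ (2 * T))} := by
  have hcard : Fintype.card (Row ns) = ∑ i, ns i := by simp
  have hcard2 : 2 ≤ Fintype.card (Row ns) := hcard ▸ hn
  have hm : 0 < m := by
    rcases Nat.eq_zero_or_pos m with rfl | h
    · simp at hn
    · exact h
  set Ξ := consensusMatrix X W c with hΞ
  have hlaw : HasLaw q (multivariateGaussian 0 Ω) P := by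
    rw [funext hq, hΩ]
    exact hasLaw_iterate X W c α σq σp T q0 p hq0 hp hindep
  refine ⟨hlaw, fun γ hγ Δ Θ hΘ hΔ => ?_⟩
  have hgap : lam 2 < lam 1 := eigenvalue_gap_pos hcard2 hlam hμ hdist hμ2
  have hΩpsd : Ω.PosSemidef := hΩ ▸ posSemidef_outputCov _ _ _ _ _
  obtain ⟨⟨u, hu⟩, hord⟩ := hμ
  replace hu : ∀ i, Matrix.toEuclideanCLM (𝕜 := ℝ) Ξ (u i) = μ (i + 1) • u i := hu
  have hμ12 : |μ 2| ≤ |μ 1| := hord 1 2 le_rfl (by norm_num) hcard2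
  have hμ1 : μ 1 ≠ 0 := fun h => hμ2 (by
    rw [h, abs_zero] at hμ12
    exact abs_nonpos_iff.1 hμ12)
  let i₀ : Fin (Fintype.card (Row ns)) := ⟨0, by omega⟩
  set a : Fin (Fintype.card (Row ns)) → ℝ := fun i => covEigenvalue α σq σp T (μ (i + 1)) with ha
  have ha0 : ∀ i, 0 ≤ a i := fun i => covEigenvalue_nonneg _ _ _ _ _
  have hΩu : ∀ i, Matrix.toEuclideanCLM (𝕜 := ℝ) Ω (u i) = a i • u i := fun i => by
    rw [hΩ]
    exact toEuclideanCLM_outputCov_apply (transpose_consensusMatrix X hW.symm c) _ _ _ _ (hu i)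
  have htrace : Ω.trace = ∑ i, a i := by
    rw [trace_eq_sum_inner Ω u]
    refine Finset.sum_congr rfl fun i _ => ?_
    rw [hΩu, inner_smul_right, real_inner_self_eq_norm_sq, u.norm_eq_one]
    ring
  have hfrob : frobNorm Ω ^ 2 = ∑ i, a i ^ 2 := by
    rw [frobNorm_sq, ← Matrix.conjTranspose_eq_transpose_of_trivial, hΩpsd.isHermitian.eq,
      trace_eq_sum_inner _ u]
    refine Finset.sum_congr rfl fun i _ => ?_
    rw [map_mul, mul_apply_eq_comp, hΩu, map_smul, hΩu, smul_smul, inner_smul_right,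
      real_inner_self_eq_norm_sq, u.norm_eq_one]
    ring
  have hpos1 : 0 < a i₀ := covEigenvalue_pos hα hσq σp T hμ1
  have htr : 0 < Ω.trace := by
    rw [htrace]
    exact Finset.sum_pos' (fun i _ => ha0 i) ⟨i₀, Finset.mem_univ _, hpos1⟩
  set B₁ := ((Finset.univ.sup ns : ℕ) : ℝ) * m * |w 2| ^ c / (lam 1 - lam 2) with hB₁
  set τ := covEigenvalue α σq σp T (μ 2) / covEigenvalue α σq σp T (μ 1) with hτ
  have hτ0 : 0 ≤ τ := div_nonneg (covEigenvalue_nonneg _ _ _ _ _) (covEigenvalue_nonneg _ _ _ _ _)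
  have hτ1 : τ ≤ 1 := div_le_one_of_le₀ (covEigenvalue_mono _ _ _ _ hμ12)
    (covEigenvalue_nonneg _ _ _ _ _)
  have hB₁0 : 0 ≤ B₁ := div_nonneg (by positivity) (by linarith)
  have hB₂0 : 0 ≤ ((Fintype.card (Row ns) : ℝ) - 1) * τ := by
    have : (2 : ℝ) ≤ Fintype.card (Row ns) := by exact_mod_cast hcard2
    exact mul_nonneg (by linarith) hτ0
  have hEB : ‖Ξ - gram X‖ / (lam 1 - lam 2) ≤ B₁ :=
    div_le_div_of_nonneg_right (norm_consensusMatrix_sub_gram_le hm hX hW.stochastic hw c)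
      (by linarith)
  -- The sine theorem needs an error below half the gap; otherwise `2 * B₁ ≥ 1` and the left side is
  -- nonpositive.
  have hp₀ : 1 - 2 * B₁ ≤ inner ℝ (u i₀) v ^ 2 := by
    rcases lt_or_ge (2 * ‖Ξ - gram X‖) (lam 1 - lam 2) with h | h
    · have := one_sub_inner_sq_le (posSemidef_gram X) hlam hcard2 hord u hu i₀ rfl hv hv_eig h
      linarith
    · have h1 : 1 / 2 ≤ ‖Ξ - gram X‖ / (lam 1 - lam 2) := by
        rw [le_div_iff₀ (by linarith)]
        linarith
      linarith [sq_nonneg (inner ℝ (u i₀) v)]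
  have hdom : ∀ i, i ≠ i₀ → a i ≤ τ * a i₀ := fun i hi => by
    have hi0 : (i : ℕ) ≠ 0 := fun h => hi (Fin.ext h)
    have h : τ * a i₀ = covEigenvalue α σq σp T (μ 2) := div_mul_cancel₀ _ hpos1.ne'
    rw [h]
    exact covEigenvalue_mono _ _ _ _ (hord 2 (i + 1) (by norm_num) (by omega) i.2)
  -- Squaring gives the factor `τ ^ 2`, which is at most `τ` because `τ ≤ 1`; the same `B` therefore
  -- serves for the squared eigenvalues.
  have hdomsq : ∀ i, i ≠ i₀ → a i ^ 2 ≤ τ * a i₀ ^ 2 := fun i hi => by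
    refine (pow_le_pow_left₀ (ha0 i) (hdom i hi) 2).trans ?_
    rw [mul_pow]
    exact mul_le_mul_of_nonneg_right (by nlinarith) (sq_nonneg _)
  -- In the eigenbasis `vᵀΩv = ∑ aᵢ ⟨uᵢ, v⟩²` and `‖Ωv‖² = ∑ aᵢ² ⟨uᵢ, v⟩²`, so both conditions are
  -- instances of the same concentration-of-weights lemma.
  have key := le_measureReal_sinSq_le hΩpsd htr hv (Θ := Θ)
    (B := 2 * (B₁ + ((Fintype.card (Row ns) : ℝ) - 1) * τ)) hγ (by linarith) fun hB => by
      constructor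
      · rw [htrace, ← Matrix.inner_toEuclideanCLM, inner_self_apply_eigenbasis u hΩu]
        exact one_sub_mul_sum_le_sum_mul ha0 (fun i => sq_nonneg _) hdom
          (by rw [Fintype.card_fin]) hB₂0 hp₀ hB₁0 hB
      · rw [hfrob, norm_sq_apply_eigenbasis u hΩu]
        exact one_sub_mul_sum_le_sum_mul (fun i => sq_nonneg _) (fun i => sq_nonneg _) hdomsq
          (by rw [Fintype.card_fin]) hB₂0 hp₀ hB₁0 hB
  have hms : MeasurableSet {y : EuclideanSpace ℝ (Row ns) | y ≠ 0 ∧ sinSq v y ≤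
      deviation Ω v Θ γ + 2 * (B₁ + ((Fintype.card (Row ns) : ℝ) - 1) * τ)} := by
    have h : Measurable (sinSq v) := by
      have hc : Continuous fun y : EuclideanSpace ℝ (Row ns) =>
          ‖Matrix.toEuclideanCLM (𝕜 := ℝ) (projPerp v) y‖ ^ 2 := by fun_prop
      exact hc.measurable.div (by fun_prop)
    exact (measurableSet_singleton 0).compl.inter (h measurableSet_Iic)
  rw [mul_assoc _ (noiseRatio α (μ 1) (μ 2) σq σp T), noiseRatio_mul_eq hα σq σp T hμ1 hμ2, ← hτ,
    ← hcard]
  rwa [← hlaw.measureReal_eq hms] at key
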